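/- Let $V$ be a finite-dimensional complex vector space and $R\subset V$ a subset spanning $V$. "Algebraic subgroup" means Zariski closed subgroup, over $\mathbb C$ in (1) and (2), and over $\mathbb R$ in (3), where $U(V,h)$ is regarded as a real algebraic group. A subspace $U$ of $V$ is called nontrivial if $U\ne 0$ and $U\neq V$, and $U^\perp$ is its orthogonal complement for the given form. (1) Let $Q$ be a non-degenerate alternating bilinear form on $V$, and let $M$ be the smallest algebraic subgroup of the symplectic group $Sp(V,Q)$ containing the transvections $x\mapsto x+Q(x,\delta)\delta$ for all $\delta\in R$. Suppose that $R$ is a finite union of $M$-orbits. Then at least one of the following holds: (a) there is a nontrivial $M$-invariant subspace $U$ of $V$ such that $R\subset U\cup U^{\perp}$; (b) $M=Sp(V,Q)$. (2) Let $Q$ be a non-degenerate symmetric bilinear form on $V$, assume $Q(\delta,\delta)=2$ for all $\delta\in R$, and let $M$ be the smallest algebraic subgroup of the orthogonal group $O(V,Q)$ containing the reflections $x\mapsto x-Q(x,\delta)\delta$ for all $\delta\in R$. Suppose that $R$ is a finite union of $M$-orbits. Then at least one of the following holds: (a) there is a nontrivial $M$-invariant subspace $U$ of $V$ such that $R\subset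 U\cup U^{\perp}$; (b) $M$ is finite; (c) $M=O(V,Q)$. (3) Let $\epsilon\in\{1,-1\}$, let $\lambda\neq\pm1$ be a root of unity, and let $h$ be a non-degenerate Hermitian form on $V$ (linear in the first variable) of signature $(p,q)$ with $p+q=\dim_{\mathbb C} V>1$. Assume $h(\delta,\delta)=\epsilon$ for all $\delta\in R$, and let $M$ be the smallest (real) algebraic subgroup of the unitary group $U(V,h)$ containing the complex reflections $x\mapsto x+\epsilon(\lambda-1)h(x,\delta)\delta$ for all $\delta\in R$. Suppose that $R$ is a finite union of $M$-orbits. Then at least one of the following holds: (a) there is a nontrivial $M$-invariant subspace $U$ of $V$ such that $R\subset U\cup U^{\perp}$; (b) $M$ is finite; (c) $PM=PU(V,h)$, where $PU(V,h)$ is the quotient of $U(V,h)$ by its center and $PM$ is the image of $M$ in it. -/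

import Mathlib

/-- The ring of polynomial functions on a `k`-vector space `W`: the `k`-algebra of functions
generated by the `k`-linear functionals. -/
def polyFunctionAlgebra (k W : Type*) [Field k] [AddCommGroup W] [Module k W] :
    Subalgebra k (W → k) :=
  Algebra.adjoin k (Set.range fun (φ : Module.Dual k W) (w : W) => φ w)

/-- `S` is Zariski closed over `k`: it is the set of common zeros of a family of polynomial
functions with coefficients in `k`. -/
def IsZariskiClosed (k : Type*) {W : Type*} [Field k] [AddCommGroup W] [Module k W]
    (S : Set W) : Prop :=
  ∃ P : Set (W → k), P ⊆ (polyFunctionAlgebra k W : Set (W → k)) ∧ S = {w | ∀ p ∈ P, p w = 0}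

section

variable {V : Type*} [AddCommGroup V] [Module ℂ V]

/-- A subgroup of `GL(V)` is algebraic over `k` if it is the trace on `GL(V)` of a Zariski closed
subset of `End(V)`. For `k = ℂ` these are the complex algebraic subgroups of `GL(V)`; for `k = ℝ`
the polynomial equations are in the real coordinates of `End(V)`, and these are the real algebraic
subgroups of `GL(V)` seen as a real algebraic group. -/
def IsAlgebraicSubgroup (k : Type*) [Field k] [Module k (Module.End ℂ V)]
    (N : Subgroup (V ≃ₗ[ℂ] V)) : Prop :=
  ∃ Z : Set (Module.End ℂ V), IsZariskiClosed k Z ∧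
    ∀ g : V ≃ₗ[ℂ] V, g ∈ N ↔ (g : V →ₗ[ℂ] V) ∈ Z

/-- The group of linear automorphisms of `V` preserving the form `B`: it is `Sp(V, B)`,
`O(V, B)`, `U(V, B)` for `B` nondegenerate alternating, symmetric, Hermitian. -/
def isometryGroup {σ : ℂ →+* ℂ} (B : V →ₗ[ℂ] V →ₛₗ[σ] ℂ) : Subgroup (V ≃ₗ[ℂ] V) where
  carrier := {g | ∀ x y, B (g x) (g y) = B x y}
  one_mem' := fun _ _ => rfl
  mul_mem' := fun {a b} ha hb x y => (ha (b x) (b y)).trans (hb x y)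
  inv_mem' := fun {a} ha x y => by
    have h := ha (a⁻¹ x) (a⁻¹ y)
    have e : ∀ z, a (a⁻¹ z) = z := fun z => a.apply_symm_apply z
    rw [e, e] at h
    exact h.symm

/-- The map `x ↦ x + c B(x, δ) δ`. -/
def rankOnePerturbation {σ : ℂ →+* ℂ} (B : V →ₗ[ℂ] V →ₛₗ[σ] ℂ) (c : ℂ) (δ : V) :
    Module.End ℂ V where
  toFun x := x + (c * B x δ) • δ
  map_add' x y := by
    simp only [map_add, LinearMap.add_apply, mul_add, add_smul]
    abel
  map_smul' a x := by
    simp only [map_smul, LinearMap.smul_apply, smul_eq_mul, RingHom.id_apply, smul_add, smul_smul]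
    congr 2
    ring

/-- The algebraic (over `k`) subgroups of `G` that contain all the maps in `T`. -/
def algebraicSubgroupsContaining (k : Type*) [Field k] [Module k (Module.End ℂ V)]
    (G : Subgroup (V ≃ₗ[ℂ] V)) (T : Set (Module.End ℂ V)) : Set (Subgroup (V ≃ₗ[ℂ] V)) :=
  {N | N ≤ G ∧ IsAlgebraicSubgroup k N ∧ ∀ t ∈ T, ∃ g ∈ N, (g : V →ₗ[ℂ] V) = t}

/-- The smallest algebraic (over `k`) subgroup of `G` that contains all the maps in `T`. -/
def algebraicHull (k : Type*) [Field k] [Module k (Module.End ℂ V)]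
    (G : Subgroup (V ≃ₗ[ℂ] V)) (T : Set (Module.End ℂ V)) : Subgroup (V ≃ₗ[ℂ] V) :=
  sInf (algebraicSubgroupsContaining k G T)

/-- The intersection defining `algebraicHull` is a minimum as soon as `G` is algebraic and contains
the maps in `T`. -/
theorem isLeast_algebraicHull (k : Type*) [Field k] [Module k (Module.End ℂ V)]
    (G : Subgroup (V ≃ₗ[ℂ] V)) (T : Set (Module.End ℂ V)) (hG : IsAlgebraicSubgroup k G)
    (hT : ∀ t ∈ T, ∃ g ∈ G, (g : V →ₗ[ℂ] V) = t) :
    IsLeast (algebraicSubgroupsContaining k G T) (algebraicHull k G T) := by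
  refine ⟨⟨sInf_le ⟨le_rfl, hG, hT⟩, ?_, ?_⟩, fun N hN => sInf_le hN⟩
  · have hc : ∀ N : algebraicSubgroupsContaining k G T, ∃ P : Set (Module.End ℂ V → k),
        P ⊆ (polyFunctionAlgebra k (Module.End ℂ V) : Set (Module.End ℂ V → k)) ∧
        ∀ g : V ≃ₗ[ℂ] V, g ∈ N.1 ↔ ∀ p ∈ P, p (g : V →ₗ[ℂ] V) = 0 := by
      rintro ⟨N, -, ⟨Z, ⟨P, hP, rfl⟩, hZ⟩, -⟩
      exact ⟨P, hP, hZ⟩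
    choose P hP hPN using hc
    refine ⟨{w | ∀ p ∈ ⋃ N, P N, p w = 0},
      ⟨_, Set.iUnion_subset hP, rfl⟩, fun g => ?_⟩
    simp only [algebraicHull, Subgroup.mem_sInf, Set.mem_ofPred_eq, Set.mem_iUnion]
    constructor
    · rintro h p ⟨N, hp⟩
      exact (hPN N g).1 (h N.1 N.2) p hp
    · intro h N hN
      exact (hPN ⟨N, hN⟩ g).2 fun p hp => h p ⟨_, hp⟩
  · intro t ht
    obtain ⟨g, -, hg⟩ := hT t ht
    refine ⟨g, Subgroup.mem_sInf.2 fun N hN => ?_, hg⟩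
    obtain ⟨g', hg', e⟩ := hN.2.2 t ht
    rwa [← LinearEquiv.toLinearMap_injective (e.trans hg.symm)]

/-- `R` is the union of finitely many orbits of `M`. -/
def IsFiniteUnionOfOrbits (M : Subgroup (V ≃ₗ[ℂ] V)) (R : Set V) : Prop :=
  ∃ S : Set V, S.Finite ∧ R = ⋃ v ∈ S, MulAction.orbit M v

/-- There is an `M`-invariant subspace `U` of `V`, different from `0` and `V`, such that `R` is
contained in the union of `U` and its orthogonal complement with respect to `B`. -/
def SplitsOrthogonally {σ : ℂ →+* ℂ} (B : V →ₗ[ℂ] V →ₛₗ[σ] ℂ) (M : Subgroup (V ≃ₗ[ℂ] V))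
    (R : Set V) : Prop :=
  ∃ U : Submodule ℂ V, U ≠ ⊥ ∧ U ≠ ⊤ ∧ (∀ g ∈ M, ∀ u ∈ U, g u ∈ U) ∧
    R ⊆ (U : Set V) ∪ (U.orthogonalBilin B : Set V)

/-- The adjoint group `PAut(V, B)`: the isometry group modulo its center. -/
abbrev ProjectiveIsometryGroup {σ : ℂ →+* ℂ} (B : V →ₗ[ℂ] V →ₛₗ[σ] ℂ) : Type _ :=
  isometryGroup B ⧸ Subgroup.center (isometryGroup B)

/-- The image `PM` of a group `M` of isometries in `PAut(V, B)`. -/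
def projectiveImage {σ : ℂ →+* ℂ} (B : V →ₗ[ℂ] V →ₛₗ[σ] ℂ) (M : Subgroup (V ≃ₗ[ℂ] V)) :
    Subgroup (ProjectiveIsometryGroup B) :=
  (M.subgroupOf (isometryGroup B)).map (QuotientGroup.mk' (Subgroup.center (isometryGroup B)))

end

/-!
An infinite real algebraic group `M` contains a nonconstant curve: a nonzero derivation of the
function field of a positive-dimensional component is, up to denominators, a polynomial vector
field, and one of its integral curves stays in the component. As `M` is closed, its Lie algebra `L`
is then nonzero.

Conjugating `X ∈ L` by the reflection in `δ ∈ R` changes `X` by a multiple of the infinitesimal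
rotation of `δ` towards the component of `X δ` orthogonal to `δ`. The vectors towards which `L`
rotates `δ` span, together with `δ`, a subspace `U`; moving one rotation by another shows
`R ⊆ U ∪ Uᗮ`. So either `R` splits orthogonally or `L` rotates `δ` in every direction, and
exponentials of rotations together with the theorem of Cartan and Dieudonné recover the isometry
group. In the symplectic case the symmetric tensors `δ ⊗ v` play the role of the rotations, and
symplectic transvections that of the reflections.

In the unitary case two things happen only up to scalars. `L` could consist of scalars, but these
are excluded because the determinants of the elements of `M` are roots of unity of bounded order;
and the commutators of rotations only produce the skew-Hermitian endomorphisms up to multiples of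
the identity, whence a statement about `PM`.
-/

section RealAlgebraicSets

open MvPolynomial Filter Topology

theorem exists_isPrime_infinite_inter_zeroLocus {σ k : Type*} [Finite σ] [Field k]
    {G : Set (σ → k)} {J : Ideal (MvPolynomial σ k)} (hJ : (G ∩ zeroLocus k J).Infinite) :
    ∃ I : Ideal (MvPolynomial σ k), J ≤ I ∧ I.IsPrime ∧ (G ∩ zeroLocus k I).Infinite ∧
      ∀ f ∉ I, {z ∈ G ∩ zeroLocus k I | aeval z f = 0}.Finite := by
  obtain ⟨I, ⟨hJI, hI⟩, hmax⟩ := set_has_maximal_iff_noetherian.2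
    (inferInstanceAs (IsNoetherianRing (MvPolynomial σ k)))
    {I : Ideal (MvPolynomial σ k) | J ≤ I ∧ (G ∩ zeroLocus k I).Infinite} ⟨J, le_rfl, hJ⟩
  have hfin : ∀ f ∉ I, {z ∈ G ∩ zeroLocus k I | aeval z f = 0}.Finite := by
    intro f hf
    by_contra hinf
    refine hmax (I ⊔ Ideal.span {f}) ⟨hJI.trans le_sup_left, Set.Infinite.mono ?_ hinf⟩
      (left_lt_sup.2 fun h => hf (h (Ideal.mem_span_singleton_self f)))
    rintro z ⟨⟨hzG, hzI⟩, hzf⟩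
    have : I ⊔ Ideal.span {f} ≤ RingHom.ker (aeval z : MvPolynomial σ k →ₐ[k] k) :=
      sup_le hzI ((Ideal.span_singleton_le_iff_mem _).2 hzf)
    exact ⟨hzG, this⟩
  refine ⟨I, hJI, ⟨?_, fun {f g} hfg => ?_⟩, hI, hfin⟩
  · rintro rfl
    obtain ⟨z, -, hz⟩ := hI.nonempty
    simpa using hz 1 Submodule.mem_top
  · by_contra! h
    refine hI (((hfin f h.1).union (hfin g h.2)).subset fun z hz => ?_)
    have hz0 := hz.2 _ hfg
    rw [map_mul, mul_eq_zero] at hz0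
    exact hz0.imp (⟨hz, ·⟩) (⟨hz, ·⟩)

theorem finite_zeroLocus_of_isAlgebraic {σ k : Type*} [Finite σ] [Field k]
    (I : Ideal (MvPolynomial σ k)) [Algebra.IsAlgebraic k (MvPolynomial σ k ⧸ I)] :
    (zeroLocus k I).Finite := by
  choose p hp0 hp using fun i =>
    Algebra.IsAlgebraic.isAlgebraic (R := k) (Ideal.Quotient.mkₐ k I (X i))
  refine (Set.Finite.pi' fun i => (p i).rootSet_finite k).subset fun z hz i => ?_
  have hpi : Polynomial.aeval (X i) (p i) ∈ I := by
    rw [← Ideal.Quotient.eq_zero_iff_mem, ← hp i, Polynomial.aeval_algHom_apply]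
    rfl
  rw [Polynomial.mem_rootSet]
  refine ⟨hp0 i, ?_⟩
  have hzi := hz _ hpi
  rwa [← Polynomial.aeval_algHom_apply, aeval_X] at hzi

theorem exists_derivation_ne_zero (k K : Type*) [Field k] [Field K] [Algebra k K]
    [Algebra.EssFiniteType k K] (hK : ¬ Algebra.IsAlgebraic k K) :
    ∃ D : Derivation k K K, D ≠ 0 := by
  by_contra! h
  have hΩ : Subsingleton (Ω[K⁄k]) := by
    refine subsingleton_of_forall_eq 0 fun x =>
      (Module.forall_dual_apply_eq_zero_iff K x).1 fun φ => ?_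
    have hφ : φ = 0 :=
      (KaehlerDifferential.linearMapEquivDerivation k K).injective ((h _).trans (h _).symm)
    rw [hφ, LinearMap.zero_apply]
  have : Algebra.FormallyUnramified k K := ⟨hΩ⟩
  have := Algebra.FormallyUnramified.isSeparable k K
  exact hK inferInstance

/-- The factor `b` is a common denominator of the `D (X i)`. -/
theorem exists_derivation_lift {σ k K : Type*} [Finite σ] [Field k] {I : Ideal (MvPolynomial σ k)}
    [Field K] [Algebra k K] [Algebra (MvPolynomial σ k) K] [IsScalarTower k (MvPolynomial σ k) K]
    [Algebra (MvPolynomial σ k ⧸ I) K] [IsScalarTower (MvPolynomial σ k) (MvPolynomial σ k ⧸ I) K]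
    [IsFractionRing (MvPolynomial σ k ⧸ I) K] (D : Derivation k K K) :
    ∃ b : K, b ≠ 0 ∧ ∃ θ : Derivation k (MvPolynomial σ k) (MvPolynomial σ k),
      ∀ f, algebraMap (MvPolynomial σ k) K (θ f) = b * D (algebraMap (MvPolynomial σ k) K f) := by
  obtain ⟨⟨b, hb⟩, hbD⟩ := IsLocalization.exist_integer_multiples_of_finite
    (nonZeroDivisors (MvPolynomial σ k ⧸ I)) fun i => D (algebraMap (MvPolynomial σ k) K (X i))
  choose c hc using hbD
  choose d hd using fun i => Ideal.Quotient.mk_surjective (c i)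
  have : Nontrivial (MvPolynomial σ k ⧸ I) :=
    (algebraMap (MvPolynomial σ k ⧸ I) K).domain_nontrivial
  refine ⟨algebraMap _ K b, ?_, mkDerivation k d, fun f => ?_⟩
  · rw [Ne, map_eq_zero_iff _ (IsFractionRing.injective (MvPolynomial σ k ⧸ I) K)]
    exact nonZeroDivisors.ne_zero hb
  · have hcomp : (Algebra.linearMap (MvPolynomial σ k) K).compDer (mkDerivation k d) =
        algebraMap _ K b • D.compAlgebraMap (MvPolynomial σ k) := by
      refine MvPolynomial.derivation_ext fun i => ?_
      have hdc : algebraMap (MvPolynomial σ k) K (d i) = algebraMap _ K (c i) := by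
        rw [← hd i, IsScalarTower.algebraMap_apply (MvPolynomial σ k) (MvPolynomial σ k ⧸ I) K]
        rfl
      simpa [mkDerivation_X, hdc, Algebra.smul_def] using hc i
    exact DFunLike.congr_fun hcomp f

theorem exists_derivation_preserving {σ k : Type*} [Finite σ] [Field k]
    (I : Ideal (MvPolynomial σ k)) [I.IsPrime] (hI : (zeroLocus k I).Infinite) :
    ∃ θ : Derivation k (MvPolynomial σ k) (MvPolynomial σ k),
      (∀ f ∈ I, θ f ∈ I) ∧ ∃ i, θ (X i) ∉ I := by
  let B := MvPolynomial σ k ⧸ I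
  let K := FractionRing B
  have : Algebra.EssFiniteType B K :=
    Algebra.EssFiniteType.of_isLocalization K (nonZeroDivisors B)
  have : Algebra.EssFiniteType k K := Algebra.EssFiniteType.comp k B K
  have hK : ¬ Algebra.IsAlgebraic k K := fun _ =>
    have : Algebra.IsAlgebraic k B := .of_injective (IsScalarTower.toAlgHom k B K)
      (IsFractionRing.injective B K)
    hI (finite_zeroLocus_of_isAlgebraic I)
  obtain ⟨D, hD⟩ := exists_derivation_ne_zero k K hK
  obtain ⟨b, hb, θ, hθ⟩ := exists_derivation_lift (I := I) D
  have mem_iff : ∀ f, algebraMap (MvPolynomial σ k) K f = 0 ↔ f ∈ I := fun f => by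
    rw [IsScalarTower.algebraMap_apply (MvPolynomial σ k) B K,
      map_eq_zero_iff _ (IsFractionRing.injective B K)]
    exact Ideal.Quotient.eq_zero_iff_mem
  refine ⟨θ, fun f hf => ?_, ?_⟩
  · rw [← mem_iff, hθ, (mem_iff f).2 hf, map_zero, mul_zero]
  · by_contra! hall
    have hDX : D.compAlgebraMap (MvPolynomial σ k) = 0 := MvPolynomial.derivation_ext fun i =>
      (mul_eq_zero.1 ((hθ (X i)).symm.trans ((mem_iff _).2 (hall i)))).resolve_left hb
    have hDB : ∀ x : B, D (algebraMap B K x) = 0 := fun x => by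
      obtain ⟨f, rfl⟩ := Ideal.Quotient.mk_surjective x
      exact DFunLike.congr_fun hDX f
    refine hD (Derivation.ext fun x => ?_)
    obtain ⟨u, v, -, rfl⟩ := IsFractionRing.div_surjective (A := B) x
    simp [Derivation.leibniz_div, hDB]

theorem hasDerivAt_aeval {σ 𝕜 : Type*} [Finite σ] [NontriviallyNormedField 𝕜]
    (θ : Derivation 𝕜 (MvPolynomial σ 𝕜) (MvPolynomial σ 𝕜)) {γ : 𝕜 → σ → 𝕜} {t : 𝕜}
    (hγ : HasDerivAt γ (fun i => aeval (γ t) (θ (X i))) t) (f : MvPolynomial σ 𝕜) :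
    HasDerivAt (fun s => aeval (γ s) f) (aeval (γ t) (θ f)) t := by
  have := Fintype.ofFinite σ
  induction f using MvPolynomial.induction_on with
  | C a => simpa using hasDerivAt_const t a
  | add p q hp hq => simpa using hp.fun_add hq
  | mul_X p i hp => simpa [add_comm, mul_comm] using hp.fun_mul (hasDerivAt_pi.1 hγ i)

theorem contDiff_aeval {σ 𝕜 : Type*} [Fintype σ] [NontriviallyNormedField 𝕜] {n : WithTop ℕ∞}
    (f : MvPolynomial σ 𝕜) : ContDiff 𝕜 n fun z : σ → 𝕜 => aeval z f := by
  induction f using MvPolynomial.induction_on with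
  | C a => simpa using contDiff_const
  | add p q hp hq => simpa using hp.add hq
  | mul_X p i hp => simpa using hp.mul (contDiff_apply 𝕜 𝕜 i)

theorem eq_zero_of_hasDerivAt_mulVec {ι : Type*} [Fintype ι] {a b : ℝ} {F : ℝ → ι → ℝ}
    {A : ℝ → Matrix ι ι ℝ} (hA : ContinuousOn A (Set.Icc a b))
    (hF : ∀ t ∈ Set.Icc a b, HasDerivAt F ((A t).mulVec (F t)) t) (ha : F a = 0) :
    ∀ t ∈ Set.Icc a b, F t = 0 := by
  let _ : SeminormedAddCommGroup (Matrix ι ι ℝ) := Matrix.linftyOpSeminormedAddCommGroup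
  obtain ⟨C, hC⟩ := isCompact_Icc.exists_bound_of_continuousOn hA
  refine eq_zero_of_abs_deriv_le_mul_abs_self_of_eq_zero_right (K := C)
    (fun t ht => (hF t ht).continuousAt.continuousWithinAt)
    (fun t ht => (hF t (Set.Ico_subset_Icc_self ht)).hasDerivWithinAt) ha fun t ht => ?_
  exact (Matrix.linfty_opNorm_mulVec _ _).trans
    (mul_le_mul_of_nonneg_right (hC t (Set.Ico_subset_Icc_self ht)) (norm_nonneg _))

theorem integralCurve_mem_zeroLocus {σ : Type*} [Finite σ] {I : Ideal (MvPolynomial σ ℝ)}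
    {θ : Derivation ℝ (MvPolynomial σ ℝ) (MvPolynomial σ ℝ)} (hθ : ∀ f ∈ I, θ f ∈ I)
    {γ : ℝ → σ → ℝ} {a b : ℝ}
    (hγ : ∀ t ∈ Set.Icc a b, HasDerivAt γ (fun i => aeval (γ t) (θ (X i))) t)
    (ha : γ a ∈ zeroLocus ℝ I) : ∀ t ∈ Set.Icc a b, γ t ∈ zeroLocus ℝ I := by
  have := Fintype.ofFinite σ
  obtain ⟨s, rfl⟩ := (isNoetherianRing_iff_ideal_fg _).1
    (inferInstanceAs (IsNoetherianRing (MvPolynomial σ ℝ))) I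
  have hcoef : ∀ f : s, ∃ c : s → MvPolynomial σ ℝ, ∑ g : s, c g * g.1 = θ f.1 := fun f =>
    (Submodule.mem_span_range_iff_exists_fun _).1 (by
      simpa using hθ _ (Ideal.subset_span f.2))
  choose c hc using hcoef
  have hsys : ∀ t ∈ Set.Icc a b, HasDerivAt (fun t (f : s) => aeval (γ t) f.1)
      ((Matrix.of fun f g => aeval (γ t) (c f g)).mulVec fun f : s => aeval (γ t) f.1) t := by
    refine fun t ht => hasDerivAt_pi.2 fun f => ?_
    simpa only [Matrix.mulVec, dotProduct, Matrix.of_apply, ← hc f, map_sum, map_mul]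
      using hasDerivAt_aeval θ (hγ t ht) f.1
  have hcont : ContinuousOn (fun t => Matrix.of fun f g => aeval (γ t) (c f g)) (Set.Icc a b) :=
    continuousOn_pi.2 fun f => continuousOn_pi.2 fun g =>
      (contDiff_aeval (n := 0) (c f g)).continuous.comp_continuousOn fun t ht =>
        (hγ t ht).continuousAt.continuousWithinAt
  have hzero := eq_zero_of_hasDerivAt_mulVec hcont hsys
    (funext fun f => ha _ (Ideal.subset_span f.2))
  intro t ht
  have : Ideal.span (s : Set (MvPolynomial σ ℝ)) ≤
      RingHom.ker (aeval (γ t) : MvPolynomial σ ℝ →ₐ[ℝ] ℝ) :=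
    Ideal.span_le.2 fun g hg => congrFun (hzero t ht) ⟨g, hg⟩
  exact this

theorem exists_curve_of_infinite_inter_zeroLocus {σ : Type*} [Finite σ] {G : Set (σ → ℝ)}
    (hG : IsOpen G) {J : Ideal (MvPolynomial σ ℝ)} (hJ : (G ∩ zeroLocus ℝ J).Infinite) :
    ∃ (γ : ℝ → σ → ℝ) (v : σ → ℝ), v ≠ 0 ∧ HasDerivAt γ v 0 ∧
      ∀ᶠ t in 𝓝[≥] 0, γ t ∈ G ∩ zeroLocus ℝ J := by
  have := Fintype.ofFinite σ
  obtain ⟨I, hJI, _, hinf, hfin⟩ := exists_isPrime_infinite_inter_zeroLocus hJ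
  obtain ⟨θ, hθ, i, hi⟩ := exists_derivation_preserving I (hinf.mono Set.inter_subset_right)
  obtain ⟨z, hz, hzi⟩ := (hinf.sdiff (hfin _ hi)).nonempty
  have hvf : ContDiff ℝ 1 fun y : σ → ℝ => fun j => aeval y (θ (X j)) :=
    contDiff_pi.2 fun j => contDiff_aeval _
  obtain ⟨γ, hγ0, ε, hε, hγ⟩ :=
    hvf.contDiffAt.exists_forall_mem_closedBall_exists_eq_forall_mem_Ioo_hasDerivAt₀
      (x₀ := z) (0 : ℝ)
  simp only [zero_sub, zero_add] at hγ
  have hγ' := hγ 0 ⟨neg_lt_zero.2 hε, hε⟩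
  refine ⟨γ, _, fun hv => hzi ⟨hz, hγ0 ▸ congrFun hv i⟩, hγ', ?_⟩
  have hγG : ∀ᶠ t in 𝓝[≥] 0, γ t ∈ G :=
    nhdsWithin_le_nhds (hγ'.continuousAt (hG.mem_nhds (hγ0 ▸ hz.1)))
  filter_upwards [hγG, Ico_mem_nhdsGE hε] with t htG ht
  refine ⟨htG, zeroLocus_anti_mono hJI (integralCurve_mem_zeroLocus hθ (fun u hu => ?_)
    (hγ0 ▸ hz.2) t (Set.right_mem_Icc.2 ht.1))⟩
  exact hγ u ⟨(neg_lt_zero.2 hε).trans_le hu.1, hu.2.trans_lt ht.2⟩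

end RealAlgebraicSets

section PolynomialFunctions

variable {k W : Type*} [Field k] [AddCommGroup W] [Module k W]

theorem dual_mem_polyFunctionAlgebra (φ : Module.Dual k W) : ⇑φ ∈ polyFunctionAlgebra k W :=
  Algebra.subset_adjoin ⟨φ, rfl⟩

theorem IsZariskiClosed.inter {S T : Set W} (hS : IsZariskiClosed k S) (hT : IsZariskiClosed k T) :
    IsZariskiClosed k (S ∩ T) := by
  obtain ⟨P, hP, rfl⟩ := hS
  obtain ⟨Q, hQ, rfl⟩ := hT
  refine ⟨P ∪ Q, Set.union_subset hP hQ, Set.ext fun w => ?_⟩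
  simp only [Set.mem_inter_iff, Set.mem_ofPred_eq, Set.mem_union, or_imp, forall_and]

theorem exists_aeval_equivFun_eq {ι : Type*} [Finite ι] (b : Module.Basis ι k W) {f : W → k}
    (hf : f ∈ polyFunctionAlgebra k W) :
    ∃ p : MvPolynomial ι k, ∀ w, MvPolynomial.aeval (b.equivFun w) p = f w := by
  have := Fintype.ofFinite ι
  induction hf using Algebra.adjoin_induction with
  | mem x hx =>
    obtain ⟨φ, rfl⟩ := hx
    refine ⟨∑ i, φ (b i) • MvPolynomial.X i, fun w => ?_⟩
    change _ = φ w
    conv_rhs => rw [← b.sum_equivFun w, map_sum]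
    simp [mul_comm]
  | algebraMap r => exact ⟨MvPolynomial.C r, fun w => by simp⟩
  | add x y _ _ hx hy =>
    obtain ⟨p, hp⟩ := hx
    obtain ⟨q, hq⟩ := hy
    exact ⟨p + q, fun w => by simp only [map_add, hp, hq, Pi.add_apply]⟩
  | mul x y _ _ hx hy =>
    obtain ⟨p, hp⟩ := hx
    obtain ⟨q, hq⟩ := hy
    exact ⟨p * q, fun w => by simp only [map_mul, hp, hq, Pi.mul_apply]⟩

theorem IsZariskiClosed.exists_preimage_zeroLocus {ι : Type*} [Finite ι] (b : Module.Basis ι k W)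
    {Z : Set W} (hZ : IsZariskiClosed k Z) :
    ∃ J : Ideal (MvPolynomial ι k), Z = b.equivFun ⁻¹' MvPolynomial.zeroLocus k J := by
  obtain ⟨P, hP, rfl⟩ := hZ
  choose q hq using fun p : P => exists_aeval_equivFun_eq b (hP p.2)
  refine ⟨Ideal.span (Set.range q), Set.ext fun w => ⟨fun hw => ?_, fun hw p hp => ?_⟩⟩
  · have : Ideal.span (Set.range q) ≤ RingHom.ker (MvPolynomial.aeval (b.equivFun w)) := by
      rw [Ideal.span_le]
      rintro _ ⟨p, rfl⟩
      exact (hq p w).trans (hw p p.2)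
    exact this
  · exact (hq ⟨p, hp⟩ w).symm.trans (hw _ (Ideal.subset_span ⟨_, rfl⟩))

theorem exists_polynomial_eval_eq_on_line {f : W → k} (hf : f ∈ polyFunctionAlgebra k W)
    (a b : W) : ∃ p : Polynomial k, ∀ t : k, p.eval t = f (a + t • b) := by
  induction hf using Algebra.adjoin_induction with
  | mem x hx =>
    obtain ⟨φ, rfl⟩ := hx
    exact ⟨Polynomial.C (φ a) + Polynomial.C (φ b) * Polynomial.X, fun t => by
      simp only [Polynomial.eval_add, Polynomial.eval_mul, Polynomial.eval_C, Polynomial.eval_X,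
        map_add, map_smul, smul_eq_mul, mul_comm]⟩
  | algebraMap r => exact ⟨Polynomial.C r, fun w => by simp⟩
  | add x y _ _ hx hy =>
    obtain ⟨p, hp⟩ := hx
    obtain ⟨q, hq⟩ := hy
    exact ⟨p + q, fun w => by simp [hp, hq]⟩
  | mul x y _ _ hx hy =>
    obtain ⟨p, hp⟩ := hx
    obtain ⟨q, hq⟩ := hy
    exact ⟨p * q, fun w => by simp [hp, hq]⟩

theorem IsZariskiClosed.line_mem [CharZero k] {Z : Set W} (hZ : IsZariskiClosed k Z) {a b : W}
    (h : ∀ n : ℕ, a + (n : k) • b ∈ Z) (t : k) : a + t • b ∈ Z := by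
  obtain ⟨P, hP, rfl⟩ := hZ
  intro p hp
  obtain ⟨q, hq⟩ := exists_polynomial_eval_eq_on_line (hP hp) a b
  have hroots : Set.range (Nat.cast : ℕ → k) ⊆ {t | q.IsRoot t} := by
    rintro _ ⟨n, rfl⟩
    exact (hq n).trans (h n p hp)
  have : q = 0 := Polynomial.eq_zero_of_infinite_isRoot q
    ((Set.infinite_range_of_injective Nat.cast_injective).mono hroots)
  rw [← hq, this, Polynomial.eval_zero]

end PolynomialFunctions

section Topology

open Filter Topology

theorem differentiable_of_mem_polyFunctionAlgebra {𝕜 W : Type*} [NontriviallyNormedField 𝕜]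
    [CompleteSpace 𝕜] [NormedAddCommGroup W] [NormedSpace 𝕜 W] [FiniteDimensional 𝕜 W]
    {f : W → 𝕜} (hf : f ∈ polyFunctionAlgebra 𝕜 W) : Differentiable 𝕜 f := by
  induction hf using Algebra.adjoin_induction with
  | mem x hx =>
    obtain ⟨φ, rfl⟩ := hx
    exact (LinearMap.toContinuousLinearMap φ).differentiable
  | algebraMap r => exact differentiable_const r
  | add x y _ _ hx hy => exact hx.add hy
  | mul x y _ _ hx hy => exact hx.mul hy

theorem IsZariskiClosed.isClosed {𝕜 W : Type*} [NontriviallyNormedField 𝕜] [CompleteSpace 𝕜]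
    [NormedAddCommGroup W] [NormedSpace 𝕜 W] [FiniteDimensional 𝕜 W] {Z : Set W}
    (hZ : IsZariskiClosed 𝕜 Z) : IsClosed Z := by
  obtain ⟨P, hP, rfl⟩ := hZ
  simp only [Set.ofPred_forall]
  exact isClosed_biInter fun p hp =>
    isClosed_eq (differentiable_of_mem_polyFunctionAlgebra (hP hp)).continuous continuous_const

theorem IsZariskiClosed.exists_curve_of_infinite_inter {W : Type*} [NormedAddCommGroup W]
    [NormedSpace ℝ W] [FiniteDimensional ℝ W] {Z G : Set W} (hZ : IsZariskiClosed ℝ Z)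
    (hG : IsOpen G) (hinf : (G ∩ Z).Infinite) :
    ∃ (γ : ℝ → W) (v : W), v ≠ 0 ∧ HasDerivAt γ v 0 ∧ ∀ᶠ t in 𝓝[≥] 0, γ t ∈ G ∩ Z := by
  let b := Module.finBasis ℝ W
  let e := b.equivFun.toContinuousLinearEquiv
  obtain ⟨J, rfl⟩ := hZ.exists_preimage_zeroLocus b
  have himage : e '' (G ∩ e ⁻¹' MvPolynomial.zeroLocus ℝ J) =
      e.symm ⁻¹' G ∩ MvPolynomial.zeroLocus ℝ J := by
    rw [Set.image_inter_preimage, e.image_eq_preimage_symm]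
  obtain ⟨γ, v, hv, hd, hγ⟩ := exists_curve_of_infinite_inter_zeroLocus
    (hG.preimage e.symm.continuous) (himage ▸ hinf.image e.injective.injOn)
  refine ⟨fun t => e.symm (γ t), e.symm v, (map_ne_zero_iff _ e.symm.injective).2 hv,
    e.symm.hasFDerivAt.comp_hasDerivAt 0 hd, hγ.mono fun t ht => ⟨ht.1, ?_⟩⟩
  exact (congrArg (· ∈ MvPolynomial.zeroLocus ℝ J) (e.apply_symm_apply (γ t))).mpr ht.2

end Topology

section ClosedUnitGroup

open NormedSpace Filter Topology

theorem tendsto_pow_inv_exp_of_hasDerivAt {A : Type*} [NormedRing A] [NormedAlgebra ℝ A]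
    [CompleteSpace A] {c : ℝ → A} {x : A} (hc0 : c 0 = 1) (hc : HasDerivAt c x 0) :
    Tendsto (fun n : ℕ => c (n : ℝ)⁻¹ ^ n) atTop (𝓝 (exp x)) := by
  have := NormedAlgebra.restrictScalars ℚ ℝ A
  have hexp : HasStrictFDerivAt (exp : A → A)
      ((ContinuousLinearEquiv.refl ℝ A : A ≃L[ℝ] A) : A →L[ℝ] A) 0 :=
    hasStrictFDerivAt_exp_zero (𝕂 := ℝ)
  have hloc := hexp.to_localInverse.hasFDerivAt
  have hloc_one := hexp.localInverse_apply_image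
  have hright := hexp.eventually_right_inverse
  set log := hexp.localInverse
  rw [exp_zero, ← hc0] at hloc hloc_one hright
  have hlog : HasDerivAt (fun t => log (c t)) x 0 := hloc.comp_hasDerivAt 0 hc
  have hinv : Tendsto (fun n : ℕ => (n : ℝ)⁻¹) atTop (𝓝[≠] 0) :=
    tendsto_nhdsWithin_iff.2 ⟨tendsto_inv_atTop_nhds_zero_nat,
      (eventually_ne_atTop 0).mono fun n hn => inv_ne_zero (Nat.cast_ne_zero.2 hn)⟩
  have hslope := (hasDerivAt_iff_tendsto_slope_zero.1 hlog).comp hinv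
  refine (((exp_continuous (𝔸 := A)).tendsto x).comp hslope).congr' ?_
  filter_upwards [(hinv.mono_right nhdsWithin_le_nhds).eventually
    (hc.continuousAt.eventually hright)] with n hn
  simp only [Function.comp_apply, zero_add, hloc_one, sub_zero, inv_inv]
  rw [Nat.cast_smul_eq_nsmul, exp_nsmul, hn]

variable {A : Type*} [NormedRing A] [CompleteSpace A] {G : Subgroup Aˣ}

theorem val_mem_ofUnits_of_tendsto (hG : IsClosed (G : Set Aˣ)) {α : Type*} {l : Filter α}
    [l.NeBot] {u : α → A} (hu : ∀ᶠ n in l, u n ∈ G.ofUnits) {a : Aˣ}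
    (h : Tendsto u l (𝓝 (a : A))) : (a : A) ∈ G.ofUnits := by
  have hopen : IsOpen (Units.val '' (G : Set Aˣ)ᶜ) :=
    Units.isOpenEmbedding_val.isOpenMap _ hG.isOpen_compl
  refine ⟨a, by_contra fun ha => ?_, rfl⟩
  obtain ⟨n, ⟨g, hg, hgn⟩, ⟨g', hg', hgn'⟩⟩ :=
    (hu.and (h.eventually_mem (hopen.mem_nhds ⟨a, ha, rfl⟩))).exists
  exact hg' (Units.ext (hgn'.trans hgn.symm) ▸ hg)

variable [NormedAlgebra ℝ A]

theorem exp_mem_ofUnits_of_hasDerivAt (hG : IsClosed (G : Set Aˣ)) {c : ℝ → A} {x : A}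
    (hc0 : c 0 = 1) (hd : HasDerivAt c x 0) (hc : ∀ᶠ t in 𝓝[≥] 0, c t ∈ G.ofUnits) :
    exp x ∈ G.ofUnits := by
  have := NormedAlgebra.restrictScalars ℚ ℝ A
  have hinv : Tendsto (fun n : ℕ => (n : ℝ)⁻¹) atTop (𝓝[≥] 0) :=
    tendsto_nhdsWithin_iff.2 ⟨tendsto_inv_atTop_nhds_zero_nat,
      Eventually.of_forall fun n => Set.mem_Ici.2 (by positivity)⟩
  exact val_mem_ofUnits_of_tendsto hG (a := (isUnit_exp x).unit)
    ((hinv.eventually hc).mono fun n hn => pow_mem hn n)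
    (tendsto_pow_inv_exp_of_hasDerivAt hc0 hd)

theorem exp_smul_mem_ofUnits_of_hasDerivAt (hG : IsClosed (G : Set Aˣ)) {c : ℝ → A} {x : A}
    (hc0 : c 0 = 1) (hd : HasDerivAt c x 0) (hc : ∀ᶠ t in 𝓝[≥] 0, c t ∈ G.ofUnits) (t : ℝ) :
    exp (t • x) ∈ G.ofUnits := by
  have := NormedAlgebra.restrictScalars ℚ ℝ A
  have hpos : ∀ s : ℝ, 0 ≤ s → exp (s • x) ∈ G.ofUnits := fun s hs => by
    have hmul : Tendsto (s * ·) (𝓝[≥] 0) (𝓝[≥] 0) :=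
      tendsto_nhdsWithin_iff.2 ⟨((continuous_const_mul s).tendsto' 0 0 (mul_zero s)).mono_left
        nhdsWithin_le_nhds, eventually_mem_nhdsWithin.mono fun r hr => mul_nonneg hs hr⟩
    refine exp_mem_ofUnits_of_hasDerivAt hG (c := fun r => c (s * r)) (by simpa using hc0) ?_
      (hmul.eventually hc)
    refine HasDerivAt.scomp 0 ?_ (by simpa using (hasDerivAt_id (0 : ℝ)).const_mul s)
    simpa using hd
  rcases le_total 0 t with ht | ht
  · exact hpos t ht
  · obtain ⟨g, hg, hgx⟩ := hpos (-t) (neg_nonneg.2 ht)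
    refine ⟨g⁻¹, G.inv_mem hg, Units.inv_eq_of_mul_eq_one_right ?_⟩
    rw [show (g : A) = exp (-t • x) from hgx,
      ← exp_add_of_commute (((Commute.refl x).smul_left _).smul_right _), ← add_smul,
      neg_add_cancel, zero_smul, exp_zero]

theorem hasDerivAt_exp_smul_zero (x : A) : HasDerivAt (fun t : ℝ => exp (t • x)) x 0 := by
  simpa using hasDerivAt_exp_smul_const (𝕂 := ℝ) x 0

theorem exp_smul_conj_mem_ofUnits {x : A} (hx : ∀ t : ℝ, exp (t • x) ∈ G.ofUnits) {u : Aˣ}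
    (hu : u ∈ G) (t : ℝ) : exp (t • ((u : A) * x * ((u⁻¹ : Aˣ) : A))) ∈ G.ofUnits := by
  have := NormedAlgebra.restrictScalars ℚ ℝ A
  rw [← smul_mul_assoc, ← mul_smul_comm, exp_units_conj]
  exact mul_mem (mul_mem ⟨u, hu, rfl⟩ (hx t)) ⟨u⁻¹, G.inv_mem hu, rfl⟩

/-- The Lie algebra of a closed group `G` of units, consisting of the generators of the
one-parameter subgroups of `G`, as a real subspace of the algebra. -/
def unitsLieSubmodule (G : Subgroup Aˣ) (hG : IsClosed (G : Set Aˣ)) : Submodule ℝ A where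
  carrier := {x | ∀ t : ℝ, exp (t • x) ∈ G.ofUnits}
  zero_mem' t := by
    rw [smul_zero, exp_zero]
    exact one_mem _
  add_mem' {x y} hx hy := by
    refine exp_smul_mem_ofUnits_of_hasDerivAt hG (c := fun t => exp (t • x) * exp (t • y))
      (by simp) ?_ (Eventually.of_forall fun t => mul_mem (hx t) (hy t))
    simpa [add_comm] using (hasDerivAt_exp_smul_zero x).fun_mul (hasDerivAt_exp_smul_zero y)
  smul_mem' r x hx t := smul_smul t r x ▸ hx (t * r)

theorem isClosed_unitsLieSubmodule (hG : IsClosed (G : Set Aˣ)) :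
    IsClosed (unitsLieSubmodule G hG : Set A) := by
  have := NormedAlgebra.restrictScalars ℚ ℝ A
  refine isClosed_of_closure_subset fun x hx t => ?_
  obtain ⟨u, hu, hux⟩ := mem_closure_iff_seq_limit.1 hx
  exact val_mem_ofUnits_of_tendsto hG (a := (isUnit_exp (t • x)).unit)
    (Eventually.of_forall fun n => hu n t)
    ((exp_continuous (𝔸 := A)).continuousAt.tendsto.comp (hux.const_smul t))

theorem lie_mem_unitsLieSubmodule (hG : IsClosed (G : Set Aˣ)) {x y : A}
    (hx : x ∈ unitsLieSubmodule G hG) (hy : y ∈ unitsLieSubmodule G hG) :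
    ⁅x, y⁆ ∈ unitsLieSubmodule G hG := by
  have := NormedAlgebra.restrictScalars ℚ ℝ A
  have hd : HasDerivAt (fun t : ℝ => exp (t • x) * y * exp (t • -x)) ⁅x, y⁆ 0 := by
    simpa [Ring.lie_def, sub_eq_add_neg] using
      ((hasDerivAt_exp_smul_zero x).mul_const y).fun_mul (hasDerivAt_exp_smul_zero (-x))
  have hmem : ∀ t : ℝ, exp (t • x) * y * exp (t • -x) ∈ unitsLieSubmodule G hG := fun t => by
    obtain ⟨u, hu, hux⟩ := hx t
    have hux' : (u : A) * exp (t • -x) = 1 := by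
      rw [show (u : A) = exp (t • x) from hux, smul_neg, ← exp_add_of_commute
        (Commute.refl _).neg_right, add_neg_cancel, exp_zero]
    rw [← Units.inv_eq_of_mul_eq_one_right hux', ← hux]
    exact exp_smul_conj_mem_ofUnits hy hu
  refine (isClosed_unitsLieSubmodule hG).mem_of_tendsto (hasDerivAt_iff_tendsto_slope_zero.1 hd)
    (Eventually.of_forall fun t => ?_)
  exact Submodule.smul_mem _ _ (Submodule.sub_mem _ (hmem _) (hmem _))

end ClosedUnitGroup

section AlgebraicUnitGroup

open NormedSpace Filter Topology

/-- A group of units of a `k`-algebra is algebraic over `k` if it is the trace on the units of a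
Zariski closed set. -/
def IsAlgebraicUnitGroup (k : Type*) {A : Type*} [Field k] [Ring A] [Algebra k A]
    (G : Subgroup Aˣ) : Prop :=
  ∃ Z : Set A, IsZariskiClosed k Z ∧ ∀ u : Aˣ, u ∈ G ↔ (u : A) ∈ Z

variable {A : Type*} [NormedRing A] {G : Subgroup Aˣ}

theorem IsAlgebraicUnitGroup.isClosed {𝕜 : Type*} [NontriviallyNormedField 𝕜] [CompleteSpace 𝕜]
    [NormedAlgebra 𝕜 A] [FiniteDimensional 𝕜 A] (hG : IsAlgebraicUnitGroup 𝕜 G) :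
    IsClosed (G : Set Aˣ) := by
  obtain ⟨Z, hZ, hGZ⟩ := hG
  rw [show (G : Set Aˣ) = Units.val ⁻¹' Z from Set.ext hGZ]
  exact hZ.isClosed.preimage Units.continuous_val

variable [CompleteSpace A]

theorem unitsLieSubmodule_ne_bot_of_infinite [NormedAlgebra ℝ A] [FiniteDimensional ℝ A]
    (hG : IsAlgebraicUnitGroup ℝ G) (hinf : (G : Set Aˣ).Infinite) :
    unitsLieSubmodule G hG.isClosed ≠ ⊥ := by
  obtain ⟨Z, hZ, hGZ⟩ := id hG
  have himage : {a : A | IsUnit a} ∩ Z = Units.val '' (G : Set Aˣ) := by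
    ext a
    constructor
    · rintro ⟨⟨u, rfl⟩, hu⟩
      exact ⟨u, (hGZ u).2 hu, rfl⟩
    · rintro ⟨u, hu, rfl⟩
      exact ⟨u.isUnit, (hGZ u).1 hu⟩
  obtain ⟨γ, v, hv, hd, hγ⟩ := hZ.exists_curve_of_infinite_inter Units.isOpen
    (himage ▸ hinf.image Units.val_injective.injOn)
  rw [himage] at hγ
  obtain ⟨u, hu, hu0⟩ := hγ.self_of_nhdsWithin Set.self_mem_Ici
  have hmem : ((u⁻¹ : Aˣ) : A) * v ∈ unitsLieSubmodule G hG.isClosed :=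
    exp_smul_mem_ofUnits_of_hasDerivAt hG.isClosed (c := fun t => ((u⁻¹ : Aˣ) : A) * γ t)
      (by rw [← hu0, Units.inv_mul]) (hd.const_mul _)
      (hγ.mono fun t ht => mul_mem ⟨u⁻¹, G.inv_mem hu, rfl⟩ ht)
  refine fun hbot => hv ((Units.mul_right_eq_zero u⁻¹).1 ?_)
  rwa [hbot, Submodule.mem_bot] at hmem

theorem exp_smul_mem_ofUnits_of_isAlgebraicUnitGroup [NormedAlgebra ℂ A] [FiniteDimensional ℂ A]
    (hG : IsAlgebraicUnitGroup ℂ G) {x : A} (hx : ∀ t : ℝ, exp (t • x) ∈ G.ofUnits) (z : ℂ) :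
    exp (z • x) ∈ G.ofUnits := by
  have := NormedAlgebra.restrictScalars ℚ ℂ A
  obtain ⟨Z, ⟨P, hP, rfl⟩, hGZ⟩ := hG
  refine ⟨(isUnit_exp (z • x)).unit, (hGZ _).2 fun p hp => ?_, rfl⟩
  have hdiff : Differentiable ℂ fun w : ℂ => p (exp (w • x)) :=
    (differentiable_of_mem_polyFunctionAlgebra (hP hp)).comp fun w =>
      (hasDerivAt_exp_smul_const (𝕂 := ℂ) x w).differentiableAt
  have hreal : ∀ t : ℝ, p (exp ((t : ℂ) • x)) = 0 := fun t => by
    obtain ⟨u, hu, hut⟩ := hx t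
    exact (congrArg p hut).symm.trans ((hGZ u).1 hu p hp)
  have htendsto : Tendsto Complex.ofReal (𝓝[≠] 0) (𝓝[≠] 0) :=
    tendsto_nhdsWithin_iff.2 ⟨(Complex.continuous_ofReal.tendsto' 0 0 rfl).mono_left
      nhdsWithin_le_nhds, eventually_mem_nhdsWithin.mono fun t ht => Complex.ofReal_ne_zero.2 ht⟩
  exact congrFun (AnalyticOnNhd.eq_of_frequently_eq (g := 0) (fun w _ => hdiff.analyticAt w)
    (fun w _ => analyticAt_const) (htendsto.frequently (Frequently.of_forall hreal))) z

end AlgebraicUnitGroup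

section GeneralLinearGroup

open NormedSpace Filter Topology

variable {V : Type*} [AddCommGroup V] [Module ℂ V]

/-- The group of units of `End(V)` corresponding to a subgroup of `GL(V)`. -/
def endUnits (M : Subgroup (V ≃ₗ[ℂ] V)) : Subgroup (Module.End ℂ V)ˣ :=
  M.comap (LinearMap.GeneralLinearGroup.generalLinearEquiv ℂ V).toMonoidHom

theorem mem_ofUnits_endUnits {M : Subgroup (V ≃ₗ[ℂ] V)} {f : Module.End ℂ V} :
    f ∈ (endUnits M).ofUnits ↔ ∃ g ∈ M, (g : V →ₗ[ℂ] V) = f := by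
  constructor
  · rintro ⟨u, hu, rfl⟩
    exact ⟨_, hu, rfl⟩
  · rintro ⟨g, hg, rfl⟩
    let e := LinearMap.GeneralLinearGroup.generalLinearEquiv ℂ V
    exact ⟨e.symm g, show e (e.symm g) ∈ M from (e.apply_symm_apply g).symm ▸ hg, rfl⟩

theorem IsAlgebraicSubgroup.isAlgebraicUnitGroup_endUnits {k : Type*} [Field k]
    [Algebra k (Module.End ℂ V)] {M : Subgroup (V ≃ₗ[ℂ] V)} (hM : IsAlgebraicSubgroup k M) :
    IsAlgebraicUnitGroup k (endUnits M) := by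
  obtain ⟨Z, hZ, hMZ⟩ := hM
  exact ⟨Z, hZ, fun u => hMZ (LinearMap.GeneralLinearGroup.generalLinearEquiv ℂ V u)⟩

theorem infinite_endUnits {M : Subgroup (V ≃ₗ[ℂ] V)} (hM : Infinite M) :
    (endUnits M : Set (Module.End ℂ V)ˣ).Infinite :=
  (Set.infinite_coe_iff.1 hM).preimage
    (by simp [(LinearMap.GeneralLinearGroup.generalLinearEquiv ℂ V).surjective.range_eq])

variable [FiniteDimensional ℂ V]

/-- A normed ring structure on the endomorphisms of a finite-dimensional complex vector space: the
operator norm of the matrices in some basis. It extends the usual ring structure. -/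
@[reducible]
noncomputable def endNormedRing : NormedRing (Module.End ℂ V) :=
  letI : NormedRing (Matrix (Fin (Module.finrank ℂ V)) (Fin (Module.finrank ℂ V)) ℂ) :=
    Matrix.linftyOpNormedRing
  NormedRing.induced _ _ (LinearMap.toMatrixAlgEquiv (Module.finBasis ℂ V))
    (LinearMap.toMatrixAlgEquiv (Module.finBasis ℂ V)).injective

attribute [local instance] endNormedRing

/-- The normed algebra structure that goes with `endNormedRing`. -/
@[reducible]
noncomputable def endNormedAlgebra : NormedAlgebra ℂ (Module.End ℂ V) :=
  letI : NormedRing (Matrix (Fin (Module.finrank ℂ V)) (Fin (Module.finrank ℂ V)) ℂ) :=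
    Matrix.linftyOpNormedRing
  letI : NormedAlgebra ℂ (Matrix (Fin (Module.finrank ℂ V)) (Fin (Module.finrank ℂ V)) ℂ) :=
    Matrix.linftyOpNormedAlgebra
  NormedAlgebra.induced ℂ _ _ (LinearMap.toMatrixAlgEquiv (Module.finBasis ℂ V))

attribute [local instance] endNormedAlgebra

theorem completeSpace_end : CompleteSpace (Module.End ℂ V) := FiniteDimensional.complete ℂ _

attribute [local instance] completeSpace_end

theorem exp_apply_of_sq_zero {X : Module.End ℂ V} {x : V} (h : X (X x) = 0) :
    exp X x = x + X x := by
  have := NormedAlgebra.restrictScalars ℚ ℂ (Module.End ℂ V)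
  rw [← sub_eq_zero, ← Module.forall_dual_apply_eq_zero_iff ℂ]
  intro φ
  rw [map_sub, sub_eq_zero, map_add]
  have hexp := (LinearMap.toContinuousLinearMap (φ ∘ₗ LinearMap.applyₗ (R := ℂ) x)).hasSum
    (exp_series_hasSum_exp' (𝕂 := ℂ) X)
  refine hexp.unique ?_
  convert hasSum_sum_of_ne_finset_zero (L := SummationFilter.unconditional ℕ)
    (s := Finset.range 2) (fun n hn => ?_) using 1
  · simp [Finset.sum_range_succ]
  · obtain ⟨m, rfl⟩ := Nat.exists_eq_add_of_le' (not_lt.1 (hn ∘ Finset.mem_range.2))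
    simp [pow_add, pow_two, h]

theorem exp_apply_of_eigenvector {X : Module.End ℂ V} {x : V} {μ : ℂ} (h : X x = μ • x) :
    exp X x = Complex.exp μ • x := by
  have := NormedAlgebra.restrictScalars ℚ ℂ (Module.End ℂ V)
  have hN : (X - algebraMap ℂ _ μ) x = 0 := by simp [h]
  have hX : exp X = exp (algebraMap ℂ (Module.End ℂ V) μ) * exp (X - algebraMap ℂ _ μ) := by
    rw [← exp_add_of_commute (Algebra.commutes _ _), add_sub_cancel]
  rw [hX, Module.End.mul_apply,
    exp_apply_of_sq_zero ((congrArg _ hN).trans (map_zero _)), hN, add_zero,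
    ← algebraMap_exp_comm, ← Complex.exp_eq_exp_ℂ, Module.algebraMap_end_apply]

variable {M : Subgroup (V ≃ₗ[ℂ] V)}

namespace IsAlgebraicSubgroup

/-- The Lie algebra of a real algebraic subgroup `M` of `GL(V)`, as a real subspace: the
endomorphisms `X` such that `exp (t • X)` lies in `M` for all real `t`. -/
noncomputable def lieAlgebra (hM : IsAlgebraicSubgroup ℝ M) : Submodule ℝ (Module.End ℂ V) :=
  unitsLieSubmodule (endUnits M) hM.isAlgebraicUnitGroup_endUnits.isClosed

variable (hM : IsAlgebraicSubgroup ℝ M)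

theorem mem_lieAlgebra_iff {X : Module.End ℂ V} :
    X ∈ hM.lieAlgebra ↔ ∀ t : ℝ, ∃ g ∈ M, (g : V →ₗ[ℂ] V) = exp (t • X) :=
  forall_congr' fun _ => mem_ofUnits_endUnits

theorem lieAlgebra_ne_bot [hinf : Infinite M] : hM.lieAlgebra ≠ ⊥ :=
  unitsLieSubmodule_ne_bot_of_infinite hM.isAlgebraicUnitGroup_endUnits (infinite_endUnits hinf)

theorem lie_mem_lieAlgebra {X Y : Module.End ℂ V} (hX : X ∈ hM.lieAlgebra)
    (hY : Y ∈ hM.lieAlgebra) : ⁅X, Y⁆ ∈ hM.lieAlgebra :=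
  lie_mem_unitsLieSubmodule _ hX hY

theorem conj_mem_lieAlgebra {g : V ≃ₗ[ℂ] V} (hg : g ∈ M) {X : Module.End ℂ V}
    (hX : X ∈ hM.lieAlgebra) :
    (g : V →ₗ[ℂ] V) * X * ((g⁻¹ : V ≃ₗ[ℂ] V) : V →ₗ[ℂ] V) ∈ hM.lieAlgebra :=
  let e := LinearMap.GeneralLinearGroup.generalLinearEquiv ℂ V
  exp_smul_conj_mem_ofUnits hX (u := e.symm g) (show e (e.symm g) ∈ M from
    (e.apply_symm_apply g).symm ▸ hg)

theorem smul_mem_lieAlgebra (hMc : IsAlgebraicSubgroup ℂ M) (c : ℂ) {X : Module.End ℂ V}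
    (hX : X ∈ hM.lieAlgebra) : c • X ∈ hM.lieAlgebra := fun t => by
  rw [← Complex.coe_smul, smul_smul]
  exact exp_smul_mem_ofUnits_of_isAlgebraicUnitGroup hMc.isAlgebraicUnitGroup_endUnits hX (t * c)

theorem mem_lieAlgebra_of_line {X : Module.End ℂ V}
    (h : ∀ t : ℝ, ∃ g ∈ M, (g : V →ₗ[ℂ] V) = 1 + t • X) : X ∈ hM.lieAlgebra :=
  exp_smul_mem_ofUnits_of_hasDerivAt hM.isAlgebraicUnitGroup_endUnits.isClosed
    (c := fun t => 1 + t • X) (by simp)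
    (by simpa using ((hasDerivAt_id (0 : ℝ)).smul_const X).const_add 1)
    (Eventually.of_forall fun t => mem_ofUnits_endUnits.2 (h t))

/-- Differentiate `B (g x) y = B x (g⁻¹ y)` along `g = exp (t • X)`. -/
theorem skew_of_mem_lieAlgebra {σ : ℂ →+* ℂ} (hσ : ∀ r : ℝ, σ r = r) {B : V →ₗ[ℂ] V →ₛₗ[σ] ℂ}
    (hMB : M ≤ isometryGroup B) {X : Module.End ℂ V} (hX : X ∈ hM.lieAlgebra) (x y : V) :
    B (X x) y = -B x (X y) := by
  let φ : Module.End ℂ V →ₗ[ℝ] ℂ :=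
    { toFun := fun f => B (f x) y
      map_add' := by simp
      map_smul' := fun r f => by
        rw [LinearMap.smul_apply, ← Complex.coe_smul, map_smul]
        simp }
  let ψ : Module.End ℂ V →ₗ[ℝ] ℂ :=
    { toFun := fun f => B x (f y)
      map_add' := by simp
      map_smul' := fun r f => by
        rw [LinearMap.smul_apply, ← Complex.coe_smul, map_smulₛₗ, hσ]
        simp }
  have hcurve (χ : Module.End ℂ V →ₗ[ℝ] ℂ) (Y : Module.End ℂ V) :
      HasDerivAt (fun t : ℝ => χ (exp (t • Y))) (χ Y) 0 :=
    (LinearMap.toContinuousLinearMap χ).hasFDerivAt.comp_hasDerivAt 0 (hasDerivAt_exp_smul_zero Y)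
  have hadjoint : (fun t : ℝ => φ (exp (t • X))) = fun t => ψ (exp (t • -X)) := by
    have := NormedAlgebra.restrictScalars ℚ ℂ (Module.End ℂ V)
    funext t
    obtain ⟨g, hg, hgX⟩ := hM.mem_lieAlgebra_iff.1 hX t
    have hinv : exp (t • X) * exp (t • -X) = 1 := by
      rw [smul_neg, ← exp_add_of_commute (Commute.refl _).neg_right, add_neg_cancel, exp_zero]
    calc B (exp (t • X) x) y = B (g x) (g (exp (t • -X) y)) := by
          rw [← LinearEquiv.coe_coe, hgX, ← Module.End.mul_apply, hinv, Module.End.one_apply]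
      _ = B x (exp (t • -X) y) := hMB hg _ _
  have h : φ X = ψ (-X) := (hcurve φ X).unique (hadjoint ▸ hcurve ψ (-X))
  simpa [φ, ψ] using h

theorem exists_exp_mem {X : Module.End ℂ V} (hX : X ∈ hM.lieAlgebra) :
    ∃ g ∈ M, (∀ x (μ : ℂ), X x = μ • x → g x = Complex.exp μ • x) ∧
      ∀ x, X (X x) = 0 → g x = x + X x := by
  obtain ⟨g, hg, hgX⟩ := hM.mem_lieAlgebra_iff.1 hX 1
  rw [one_smul] at hgX
  exact ⟨g, hg, fun x μ h => by rw [← exp_apply_of_eigenvector h, ← hgX]; rfl,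
    fun x h => by rw [← exp_apply_of_sq_zero h, ← hgX]; rfl⟩

end IsAlgebraicSubgroup

end GeneralLinearGroup

section RealStructure

variable {W : Type*} [AddCommGroup W] [Module ℂ W]

/-- The algebra of the complex-valued functions whose real and imaginary parts are real polynomial
functions. -/
def realPolyFunctionAlgebra (W : Type*) [AddCommGroup W] [Module ℂ W] : Subalgebra ℂ (W → ℂ) where
  carrier := {f | (fun w => (f w).re) ∈ polyFunctionAlgebra ℝ W ∧
    (fun w => (f w).im) ∈ polyFunctionAlgebra ℝ W}
  add_mem' hf hg := ⟨add_mem hf.1 hg.1, add_mem hf.2 hg.2⟩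
  mul_mem' hf hg := ⟨sub_mem (mul_mem hf.1 hg.1) (mul_mem hf.2 hg.2),
    add_mem (mul_mem hf.1 hg.2) (mul_mem hf.2 hg.1)⟩
  algebraMap_mem' c := ⟨algebraMap_mem (polyFunctionAlgebra ℝ W) c.re,
    algebraMap_mem (polyFunctionAlgebra ℝ W) c.im⟩

theorem conj_mem_realPolyFunctionAlgebra {f : W → ℂ} (hf : f ∈ realPolyFunctionAlgebra W) :
    (fun w => starRingEnd ℂ (f w)) ∈ realPolyFunctionAlgebra W :=
  ⟨hf.1, neg_mem hf.2⟩

theorem polyFunctionAlgebra_le_realPolyFunctionAlgebra :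
    polyFunctionAlgebra ℂ W ≤ realPolyFunctionAlgebra W :=
  Algebra.adjoin_le <| Set.range_subset_iff.2 fun φ =>
    ⟨dual_mem_polyFunctionAlgebra (Complex.reLm ∘ₗ φ.restrictScalars ℝ),
      dual_mem_polyFunctionAlgebra (Complex.imLm ∘ₗ φ.restrictScalars ℝ)⟩

theorem isZariskiClosed_real_setOf_forall_eq_zero {P : Set (W → ℂ)}
    (hP : P ⊆ (realPolyFunctionAlgebra W : Set (W → ℂ))) :
    IsZariskiClosed ℝ {w | ∀ p ∈ P, p w = 0} := by
  refine ⟨(fun p w => (p w).re) '' P ∪ (fun p w => (p w).im) '' P, ?_, ?_⟩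
  · exact Set.union_subset (Set.image_subset_iff.2 fun p hp => (hP hp).1)
      (Set.image_subset_iff.2 fun p hp => (hP hp).2)
  · ext w
    simp only [Set.mem_ofPred_eq, Set.mem_union, or_imp, forall_and, Set.forall_mem_image,
      Complex.ext_iff, Complex.zero_re, Complex.zero_im]

theorem IsZariskiClosed.real_of_complex {Z : Set W} (hZ : IsZariskiClosed ℂ Z) :
    IsZariskiClosed ℝ Z := by
  obtain ⟨P, hP, rfl⟩ := hZ
  exact isZariskiClosed_real_setOf_forall_eq_zero
    (hP.trans polyFunctionAlgebra_le_realPolyFunctionAlgebra)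

end RealStructure

section AlgebraicSubgroups

open scoped Pointwise

variable {V : Type*} [AddCommGroup V] [Module ℂ V] {N : Subgroup (V ≃ₗ[ℂ] V)}

namespace IsAlgebraicSubgroup

theorem real_of_complex (hN : IsAlgebraicSubgroup ℂ N) : IsAlgebraicSubgroup ℝ N := by
  obtain ⟨Z, hZ, hNZ⟩ := hN
  exact ⟨Z, hZ.real_of_complex, hNZ⟩

theorem inf {k : Type*} [Field k] [Module k (Module.End ℂ V)] {N' : Subgroup (V ≃ₗ[ℂ] V)}
    (hN : IsAlgebraicSubgroup k N) (hN' : IsAlgebraicSubgroup k N') :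
    IsAlgebraicSubgroup k (N ⊓ N') := by
  obtain ⟨Z, hZ, hNZ⟩ := hN
  obtain ⟨Z', hZ', hNZ'⟩ := hN'
  exact ⟨Z ∩ Z', hZ.inter hZ', fun g => and_congr (hNZ g) (hNZ' g)⟩

theorem of_forall_eq_zero {k : Type*} [Field k] [Module k (Module.End ℂ V)] {ι : Type*}
    {p : ι → Module.End ℂ V → k} (hp : ∀ i, p i ∈ polyFunctionAlgebra k (Module.End ℂ V))
    (hN : ∀ g : V ≃ₗ[ℂ] V, g ∈ N ↔ ∀ i, p i (g : V →ₗ[ℂ] V) = 0) : IsAlgebraicSubgroup k N :=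
  ⟨_, ⟨Set.range p, Set.range_subset_iff.2 hp, rfl⟩, fun g => by
    rw [hN, Set.mem_ofPred_eq, Set.forall_mem_range]⟩

theorem real_of_forall_eq_zero {ι : Type*} {p : ι → Module.End ℂ V → ℂ}
    (hp : ∀ i, p i ∈ realPolyFunctionAlgebra (Module.End ℂ V))
    (hN : ∀ g : V ≃ₗ[ℂ] V, g ∈ N ↔ ∀ i, p i (g : V →ₗ[ℂ] V) = 0) : IsAlgebraicSubgroup ℝ N :=
  ⟨_, isZariskiClosed_real_setOf_forall_eq_zero (Set.range_subset_iff.2 hp),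
    fun g => by rw [hN, Set.mem_ofPred_eq, Set.forall_mem_range]⟩

end IsAlgebraicSubgroup

theorem le_of_isLeast_algebraicSubgroupsContaining {k : Type*} [Field k]
    [Module k (Module.End ℂ V)] {G M : Subgroup (V ≃ₗ[ℂ] V)} {T : Set (Module.End ℂ V)}
    (hM : IsLeast (algebraicSubgroupsContaining k G T) M) (hN : IsAlgebraicSubgroup k N)
    (hTN : ∀ g : V ≃ₗ[ℂ] V, (g : V →ₗ[ℂ] V) ∈ T → g ∈ N) : M ≤ N := by
  obtain ⟨⟨hMG, hMalg, hTM⟩, hleast⟩ := hM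
  refine le_trans (hleast ⟨inf_le_left.trans hMG, hMalg.inf hN, fun t ht => ?_⟩) inf_le_right
  obtain ⟨g, hg, rfl⟩ := hTM t ht
  exact ⟨g, ⟨hg, hTN g ht⟩, rfl⟩

theorem dual_apply_mem_polyFunctionAlgebra (φ : Module.Dual ℂ V) (x : V) :
    (fun f : Module.End ℂ V => φ (f x)) ∈ polyFunctionAlgebra ℂ (Module.End ℂ V) :=
  dual_mem_polyFunctionAlgebra (φ ∘ₗ LinearMap.applyₗ (R := ℂ) x)

/-- The automorphisms whose determinant is an `n`-th root of unity. -/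
noncomputable def detPowOneSubgroup (V : Type*) [AddCommGroup V] [Module ℂ V] (n : ℕ) :
    Subgroup (V ≃ₗ[ℂ] V) :=
  ((powMonoidHom n).comp (LinearEquiv.det : (V ≃ₗ[ℂ] V) →* ℂˣ)).ker

theorem mem_detPowOneSubgroup {n : ℕ} {g : V ≃ₗ[ℂ] V} :
    g ∈ detPowOneSubgroup V n ↔ LinearMap.det (g : V →ₗ[ℂ] V) ^ n = 1 := by
  change LinearEquiv.det g ^ n = 1 ↔ _
  rw [Units.ext_iff, Units.val_pow_eq_pow_val, LinearEquiv.coe_det, Units.val_one]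

theorem mem_isometryGroup_iff_forall_sub_eq_zero {σ : ℂ →+* ℂ} {B : V →ₗ[ℂ] V →ₛₗ[σ] ℂ}
    {g : V ≃ₗ[ℂ] V} :
    g ∈ isometryGroup B ↔ ∀ p : V × V, B (g p.1) (g p.2) - B p.1 p.2 = 0 := by
  simp only [sub_eq_zero, Prod.forall]
  rfl

variable [FiniteDimensional ℂ V]

theorem form_apply_mem_of_dual_apply_mem {S : Subalgebra ℂ (Module.End ℂ V → ℂ)} {σ : ℂ →+* ℂ}
    (hS : ∀ (φ : Module.Dual ℂ V) (x : V), (fun f => φ (f x)) ∈ S)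
    (hσS : ∀ (φ : Module.Dual ℂ V) (x : V), (fun f => σ (φ (f x))) ∈ S)
    (B : V →ₗ[ℂ] V →ₛₗ[σ] ℂ) (x y : V) : (fun f => B (f x) (f y)) ∈ S := by
  let b := Module.finBasis ℂ V
  have hsum : (fun f : Module.End ℂ V => B (f x) (f y)) =
      ∑ i, (fun f : Module.End ℂ V => B.flip (b i) (f x)) * fun f => σ (b.coord i (f y)) := by
    funext f
    conv_lhs => rw [← b.sum_repr (f y), map_sum]
    simp [mul_comm]
  rw [hsum]
  exact sum_mem fun i _ => mul_mem (hS _ x) (hσS _ y)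

theorem isAlgebraicSubgroup_isometryGroup (B : V →ₗ[ℂ] V →ₗ[ℂ] ℂ) :
    IsAlgebraicSubgroup ℂ (isometryGroup B) :=
  .of_forall_eq_zero
    (p := fun (q : V × V) f => B (f q.1) (f q.2) - B q.1 q.2)
    (fun q => sub_mem (form_apply_mem_of_dual_apply_mem dual_apply_mem_polyFunctionAlgebra
      dual_apply_mem_polyFunctionAlgebra B q.1 q.2) (algebraMap_mem (polyFunctionAlgebra ℂ _) _))
    fun _ => mem_isometryGroup_iff_forall_sub_eq_zero

theorem isAlgebraicSubgroup_real_isometryGroup (B : V →ₗ[ℂ] V →ₗ⋆[ℂ] ℂ) :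
    IsAlgebraicSubgroup ℝ (isometryGroup B) := by
  have hdual (φ : Module.Dual ℂ V) (x : V) :
      (fun f : Module.End ℂ V => φ (f x)) ∈ realPolyFunctionAlgebra (Module.End ℂ V) :=
    polyFunctionAlgebra_le_realPolyFunctionAlgebra (dual_apply_mem_polyFunctionAlgebra φ x)
  exact .real_of_forall_eq_zero
    (p := fun (q : V × V) f => B (f q.1) (f q.2) - B q.1 q.2)
    (fun q => sub_mem (form_apply_mem_of_dual_apply_mem hdual
      (fun φ x => conj_mem_realPolyFunctionAlgebra (hdual φ x)) B q.1 q.2)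
      (algebraMap_mem (realPolyFunctionAlgebra _) _))
    fun _ => mem_isometryGroup_iff_forall_sub_eq_zero

theorem mem_stabilizer_submodule_iff {U : Submodule ℂ V} {g : V ≃ₗ[ℂ] V} :
    g ∈ MulAction.stabilizer (V ≃ₗ[ℂ] V) U ↔ ∀ u ∈ U, g u ∈ U := by
  rw [MulAction.mem_stabilizer_iff]
  refine ⟨fun h u hu => h ▸ Submodule.smul_mem_pointwise_smul u g U hu, fun h => ?_⟩
  exact Submodule.eq_of_le_of_finrank_eq (Submodule.map_le_iff_le_comap.2 h)
    (LinearEquiv.finrank_map_eq g U)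

theorem isAlgebraicSubgroup_stabilizer_submodule (U : Submodule ℂ V) :
    IsAlgebraicSubgroup ℂ (MulAction.stabilizer (V ≃ₗ[ℂ] V) U) :=
  .of_forall_eq_zero (p := fun (q : U × U.dualAnnihilator) f => q.2.1 (f q.1))
    (fun q => dual_apply_mem_polyFunctionAlgebra q.2.1 q.1) fun g => by
      simp only [mem_stabilizer_submodule_iff, Prod.forall, Subtype.forall,
        ← Subspace.forall_mem_dualAnnihilator_apply_eq_zero_iff U]
      rfl

theorem det_mem_polyFunctionAlgebra :
    (fun f : Module.End ℂ V => LinearMap.det f) ∈ polyFunctionAlgebra ℂ (Module.End ℂ V) := by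
  let b := Module.finBasis ℂ V
  have hdet : (fun f : Module.End ℂ V => LinearMap.det f) =
      ∑ s : Equiv.Perm (Fin (Module.finrank ℂ V)), (Equiv.Perm.sign s : ℤ) •
        ∏ i, fun f : Module.End ℂ V => b.coord (s i) (f (b i)) := by
    funext f
    simp [← LinearMap.det_toMatrix b, Matrix.det_apply, LinearMap.toMatrix_apply, Units.smul_def]
  rw [hdet]
  exact sum_mem fun s _ => zsmul_mem (prod_mem fun i _ => dual_apply_mem_polyFunctionAlgebra _ _) _

theorem isAlgebraicSubgroup_detPowOneSubgroup (n : ℕ) :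
    IsAlgebraicSubgroup ℂ (detPowOneSubgroup V n) :=
  .of_forall_eq_zero (p := fun (_ : Unit) f => LinearMap.det f ^ n - 1)
    (fun _ => sub_mem (pow_mem det_mem_polyFunctionAlgebra n) (one_mem _)) fun _ => by
      simp only [mem_detPowOneSubgroup, sub_eq_zero, forall_const]

end AlgebraicSubgroups

section Forms

open scoped Pointwise

variable {V : Type*} [AddCommGroup V] [Module ℂ V] {σ : ℂ →+* ℂ} {B : V →ₗ[ℂ] V →ₛₗ[σ] ℂ}

theorem rankOnePerturbation_apply (B : V →ₗ[ℂ] V →ₛₗ[σ] ℂ) (c : ℂ) (δ x : V) :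
    rankOnePerturbation B c δ x = x + (c * B x δ) • δ := rfl

theorem form_rankOnePerturbation_apply (hB : ∀ x y, B x y = σ (B y x)) {c : ℂ} {δ : V}
    (hc : c + σ c + c * σ c * B δ δ = 0) (x y : V) :
    B (rankOnePerturbation B c δ x) (rankOnePerturbation B c δ y) = B x y := by
  simp only [rankOnePerturbation_apply, map_add, LinearMap.add_apply, map_smul,
    LinearMap.map_smulₛₗ, LinearMap.smul_apply, smul_eq_mul, map_mul]
  rw [← hB δ y]
  linear_combination (B x δ * B δ y) * hc

theorem form_eq_zero_symm (hB : ∀ x y, B x y = σ (B y x)) {x y : V} (h : B x y = 0) :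
    B y x = 0 := by
  rw [hB, h, map_zero]

theorem form_eq_zero_of_isotropic (hB : ∀ x y, B x y = σ (B y x)) {D : Submodule ℂ V}
    (hD : ∀ v ∈ D, B v v = 0) {u v : V} (hu : u ∈ D) (hv : v ∈ D) : B u v = 0 := by
  by_contra h
  have huv : B ((B u v)⁻¹ • u) v = 1 := by
    rw [map_smul, LinearMap.smul_apply, smul_eq_mul, inv_mul_cancel₀ h]
  have hsum := hD ((B u v)⁻¹ • u + v) (D.add_mem (D.smul_mem _ hu) hv)
  rw [map_add, map_add, LinearMap.add_apply, LinearMap.add_apply, hD _ (D.smul_mem _ hu), huv,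
    hD v hv, hB v, huv, map_one] at hsum
  norm_num at hsum

theorem eq_zero_of_forall_form_apply_eq_zero (hn : B.Nondegenerate) {R : Set V}
    (hspan : Submodule.span ℂ R = ⊤) {v : V} (hv : ∀ r ∈ R, B r v = 0) : v = 0 := by
  have hle : Submodule.span ℂ R ≤ LinearMap.ker (B.flip v) := Submodule.span_le.2 hv
  exact hn.2 v fun x => hle (hspan ▸ Submodule.mem_top : x ∈ Submodule.span ℂ R)

theorem subset_union_orthogonalBilin_span_singleton_sup (hB : ∀ x y, B x y = σ (B y x))
    (hn : B.Nondegenerate) {R : Set V} (hspan : Submodule.span ℂ R = ⊤) {δ : V}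
    {D : Submodule ℂ V} (hD : D ≠ ⊥) (hδ : ∀ v ∈ D, B δ v = 0)
    (horth : ∀ r ∈ R, r ∉ Submodule.span ℂ {δ} ⊔ D → ∀ v ∈ D, B r v = 0)
    (hiso : ∀ r ∈ R, r ∉ Submodule.span ℂ {δ} ⊔ D → B r δ ≠ 0 → ∀ v ∈ D, B v v = 0) :
    R ⊆ ((Submodule.span ℂ {δ} ⊔ D : Submodule ℂ V) : Set V) ∪
      ((Submodule.span ℂ {δ} ⊔ D).orthogonalBilin B : Set V) := by
  intro r hr
  refine or_iff_not_imp_left.2 fun hrU => Submodule.mem_orthogonalBilin_iff.2 fun x hx => ?_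
  obtain ⟨y, hy, d, hd, rfl⟩ := Submodule.mem_sup.1 hx
  obtain ⟨a, rfl⟩ := Submodule.mem_span_singleton.1 hy
  suffices hrδ : B r δ = 0 by
    change B (a • δ + d) r = 0
    rw [map_add, LinearMap.add_apply, map_smul, LinearMap.smul_apply, form_eq_zero_symm hB hrδ,
      smul_zero, zero_add, form_eq_zero_symm hB (horth r hr hrU d hd)]
  by_contra hne
  refine hD ((Submodule.eq_bot_iff D).2 fun v hv =>
    eq_zero_of_forall_form_apply_eq_zero hn hspan fun r' hr' => ?_)
  by_cases hr'U : r' ∈ Submodule.span ℂ {δ} ⊔ D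
  · obtain ⟨y', hy', d', hd', rfl⟩ := Submodule.mem_sup.1 hr'U
    obtain ⟨a', rfl⟩ := Submodule.mem_span_singleton.1 hy'
    rw [map_add, LinearMap.add_apply, map_smul, LinearMap.smul_apply, hδ v hv, smul_zero,
      zero_add, form_eq_zero_of_isotropic hB (hiso r hr hrU hne) hd' hv]
  · exact horth r' hr' hr'U v hv

variable [FiniteDimensional ℂ V]

theorem exists_mem_isometryGroup (hn : B.Nondegenerate) {f : Module.End ℂ V}
    (hf : ∀ x y, B (f x) (f y) = B x y) :
    ∃ g ∈ isometryGroup B, (g : V →ₗ[ℂ] V) = f := by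
  have hinj : Function.Injective f := (injective_iff_map_eq_zero f).2 fun x hx =>
    hn.1 x fun y => by rw [← hf, hx, map_zero, LinearMap.zero_apply]
  exact ⟨LinearEquiv.ofInjectiveEndo f hinj, hf, LinearMap.ext fun x => rfl⟩

theorem isLeast_algebraicHull_rankOnePerturbation {k : Type*} [Field k]
    [Module k (Module.End ℂ V)] (hG : IsAlgebraicSubgroup k (isometryGroup B))
    (hn : B.Nondegenerate) {c : ℂ} {R : Set V}
    (hc : ∀ δ ∈ R, ∀ x y,
      B (rankOnePerturbation B c δ x) (rankOnePerturbation B c δ y) = B x y) :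
    IsLeast (algebraicSubgroupsContaining k (isometryGroup B) (rankOnePerturbation B c '' R))
      (algebraicHull k (isometryGroup B) (rankOnePerturbation B c '' R)) :=
  isLeast_algebraicHull k _ _ hG
    (Set.forall_mem_image.2 fun δ hδ => exists_mem_isometryGroup hn (hc δ hδ))

theorem splitsOrthogonally_of_subset {k : Type*} [Field k] [Module k (Module.End ℂ V)]
    {M : Subgroup (V ≃ₗ[ℂ] V)} {c : ℂ} {R : Set V}
    (hM : IsLeast (algebraicSubgroupsContaining k (isometryGroup B) (rankOnePerturbation B c '' R))
      M)
    {U : Submodule ℂ V} (hU : IsAlgebraicSubgroup k (MulAction.stabilizer (V ≃ₗ[ℂ] V) U))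
    (hbot : U ≠ ⊥) (htop : U ≠ ⊤) (hR : R ⊆ (U : Set V) ∪ (U.orthogonalBilin B : Set V)) :
    SplitsOrthogonally B M R := by
  have hle : M ≤ MulAction.stabilizer (V ≃ₗ[ℂ] V) U := by
    refine le_of_isLeast_algebraicSubgroupsContaining hM hU ?_
    rintro g ⟨δ, hδ, hgδ⟩
    refine mem_stabilizer_submodule_iff.2 fun u hu => ?_
    rw [← LinearEquiv.coe_coe, ← hgδ, rankOnePerturbation_apply]
    refine U.add_mem hu ?_
    rcases hR hδ with hδU | hδU
    · exact U.smul_mem _ hδU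
    · rw [Submodule.mem_orthogonalBilin_iff.1 hδU u hu, mul_zero, zero_smul]
      exact U.zero_mem
  exact ⟨U, hbot, htop, fun g hg => mem_stabilizer_submodule_iff.1 (hle hg), hR⟩

end Forms

section CartanDieudonne

variable {V : Type*} [AddCommGroup V] [Module ℂ V] {σ : ℂ →+* ℂ} {B : V →ₗ[ℂ] V →ₛₗ[σ] ℂ}

theorem exists_anisotropic_of_codisjoint (hB : ∀ x y, B x y = σ (B y x)) (hn : B.Nondegenerate)
    {E : Submodule ℂ V} (hE : Codisjoint E (E.orthogonalBilin B)) (hEtop : E ≠ ⊤) :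
    ∃ v ∈ E.orthogonalBilin B, B v v ≠ 0 := by
  by_contra! hiso
  refine hEtop (hE.eq_top_of_le (le_trans (b := ⊥) (fun f hf => ?_) bot_le))
  refine (Submodule.mem_bot ℂ).2 (hn.1 f fun x => ?_)
  obtain ⟨e, he, f', hf', rfl⟩ := Submodule.mem_sup.1 (hE.eq_top ▸ Submodule.mem_top : x ∈ _)
  rw [map_add, form_eq_zero_symm hB (Submodule.mem_orthogonalBilin_iff.1 hf e he), zero_add,
    form_eq_zero_of_isotropic hB hiso hf hf']

theorem codisjoint_sup_span_singleton (hB : ∀ x y, B x y = σ (B y x)) {E : Submodule ℂ V}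
    (hE : Codisjoint E (E.orthogonalBilin B)) {v : V} (hv : v ∈ E.orthogonalBilin B)
    (hvv : B v v ≠ 0) :
    Codisjoint (E ⊔ Submodule.span ℂ {v})
      ((E ⊔ Submodule.span ℂ {v}).orthogonalBilin B) := by
  refine codisjoint_iff_le_sup.2 fun x _ => ?_
  obtain ⟨e, he, f, hf, rfl⟩ := Submodule.mem_sup.1 (hE.eq_top ▸ Submodule.mem_top : x ∈ _)
  have hf' : f - (B f v / B v v) • v ∈ (E ⊔ Submodule.span ℂ {v}).orthogonalBilin B := by
    refine Submodule.mem_orthogonalBilin_iff.2 fun y hy => form_eq_zero_symm hB ?_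
    obtain ⟨e', he', w, hw, rfl⟩ := Submodule.mem_sup.1 hy
    obtain ⟨a, rfl⟩ := Submodule.mem_span_singleton.1 hw
    have horth : B (f - (B f v / B v v) • v) v = 0 := by
      rw [map_sub, LinearMap.sub_apply, map_smul, LinearMap.smul_apply, smul_eq_mul,
        div_mul_cancel₀ _ hvv, sub_self]
    rw [map_add, LinearMap.map_smulₛₗ, horth, smul_zero, add_zero]
    exact form_eq_zero_symm hB (Submodule.mem_orthogonalBilin_iff.1
      (sub_mem hf (Submodule.smul_mem _ _ hv)) e' he')
  have hsum : e + f = (e + (B f v / B v v) • v) + (f - (B f v / B v v) • v) := by abel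
  rw [hsum]
  exact Submodule.add_mem_sup (Submodule.add_mem_sup he
    (Submodule.smul_mem _ _ (Submodule.mem_span_singleton_self v))) hf'

variable [FiniteDimensional ℂ V]

theorem exists_quasiReflection_apply_eq (hB : ∀ x y, B x y = σ (B y x)) (hn : B.Nondegenerate)
    {u v : V} (huv : B u u = B v v) (hanis : B (v - u) (v - u) ≠ 0) :
    ∃ g ∈ isometryGroup B, ∃ c, (g : V →ₗ[ℂ] V) = rankOnePerturbation B c (v - u) ∧ g u = v := by
  have htrace : B (v - u) (v - u) = -(B u (v - u) + σ (B u (v - u))) := by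
    rw [← hB]
    simp only [map_sub, LinearMap.sub_apply]
    linear_combination -huv
  have hne : B u (v - u) ≠ 0 := fun h => hanis (by rw [htrace, h, map_zero, add_zero, neg_zero])
  have hne' : σ (B u (v - u)) ≠ 0 := (map_ne_zero σ).2 hne
  obtain ⟨g, hg, hgc⟩ := exists_mem_isometryGroup hn
    (form_rankOnePerturbation_apply hB (c := (B u (v - u))⁻¹) (δ := v - u) (by
      rw [htrace, map_inv₀]
      field_simp
      ring))
  refine ⟨g, hg, _, hgc, ?_⟩
  rw [← LinearEquiv.coe_coe, hgc, rankOnePerturbation_apply, inv_mul_cancel₀ hne, one_smul,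
    add_sub_cancel]

section

variable {N : Subgroup (V ≃ₗ[ℂ] V)} (hB : ∀ x y, B x y = σ (B y x)) (hn : B.Nondegenerate)
  (hN : ∀ g ∈ isometryGroup B, ∀ c w, B w w ≠ 0 →
    (g : V →ₗ[ℂ] V) = rankOnePerturbation B c w → g ∈ N)
include hB hn hN

/-- By the parallelogram identity `u - v` and `u + v` are not both isotropic, so one or two
quasi-reflections are enough. -/
theorem exists_mem_inf_apply_eq {u v : V} (huv : B u u = B v v) (hu : B u u ≠ 0) :
    ∃ τ ∈ isometryGroup B ⊓ N, τ u = v ∧ ∀ x, B x u = 0 → B x v = 0 → τ x = x := by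
  have hstep {u v : V} (huv : B u u = B v v) (hanis : B (v - u) (v - u) ≠ 0) :
      ∃ τ ∈ isometryGroup B ⊓ N, τ u = v ∧ ∀ x, B x (v - u) = 0 → τ x = x := by
    obtain ⟨τ, hτ, c, hτc, hτu⟩ := exists_quasiReflection_apply_eq hB hn huv hanis
    refine ⟨τ, ⟨hτ, hN τ hτ c _ hanis hτc⟩, hτu, fun x hx => ?_⟩
    rw [← LinearEquiv.coe_coe, hτc, rankOnePerturbation_apply, hx, mul_zero, zero_smul, add_zero]
  by_cases hminus : B (v - u) (v - u) = 0
  · have hplus : B (v - -u) (v - -u) ≠ 0 := by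
      simp only [map_sub, map_neg, LinearMap.sub_apply, LinearMap.neg_apply] at hminus ⊢
      intro h
      exact mul_ne_zero (by norm_num : (4 : ℂ) ≠ 0) hu (by linear_combination hminus + h + 2 * huv)
    obtain ⟨τ, hτ, hτu, hτx⟩ := hstep (u := -u) (v := v) (by simpa using huv) hplus
    obtain ⟨τ', hτ', hτu', hτx'⟩ := hstep (u := u) (v := -u) (by simp) (by
      simp only [map_sub, map_neg, LinearMap.sub_apply, LinearMap.neg_apply]
      intro h
      exact mul_ne_zero (by norm_num : (4 : ℂ) ≠ 0) hu (by linear_combination h))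
    refine ⟨τ * τ', mul_mem hτ hτ', by rw [LinearEquiv.mul_apply, hτu', hτu], fun x hxu hxv => ?_⟩
    rw [LinearEquiv.mul_apply, hτx' x (by simp [hxu]), hτx x (by simp [hxu, hxv])]
  · obtain ⟨τ, hτ, hτu, hτx⟩ := hstep huv hminus
    exact ⟨τ, hτ, hτu, fun x hxu hxv => hτx x (by rw [map_sub, hxv, hxu, sub_zero])⟩

theorem mem_of_apply_eq_self_of_codisjoint {E : Submodule ℂ V}
    (hE : Codisjoint E (E.orthogonalBilin B)) {g : V ≃ₗ[ℂ] V} (hg : g ∈ isometryGroup B)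
    (hgE : ∀ e ∈ E, g e = e) : g ∈ N := by
  induction E using WellFoundedGT.induction generalizing g with
  | ind E ih =>
  by_cases hEtop : E = ⊤
  · rw [show g = 1 from LinearEquiv.ext fun x => hgE x (hEtop ▸ Submodule.mem_top)]
    exact N.one_mem
  obtain ⟨v, hv, hvv⟩ := exists_anisotropic_of_codisjoint hB hn hE hEtop
  have hvE : ∀ e ∈ E, B e v = 0 := Submodule.mem_orthogonalBilin_iff.1 hv
  obtain ⟨τ, ⟨hτ, hτN⟩, hτv, hτx⟩ :=
    exists_mem_inf_apply_eq hB hn hN (u := v) (v := g v) (hg v v).symm hvv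
  have hτE : ∀ e ∈ E, τ e = e := fun e he => hτx e (hvE e he) (by
    rw [← hvE e he, ← hg e v, hgE e he])
  have hlt : E < E ⊔ Submodule.span ℂ {v} := left_lt_sup.2 fun hle =>
    hvv (hvE v (hle (Submodule.mem_span_singleton_self v)))
  have hfix : ∀ x ∈ E ⊔ Submodule.span ℂ {v}, (τ⁻¹ * g) x = x := by
    intro x hx
    obtain ⟨e, he, w, hw, rfl⟩ := Submodule.mem_sup.1 hx
    obtain ⟨a, rfl⟩ := Submodule.mem_span_singleton.1 hw
    refine τ.symm_apply_eq.2 ?_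
    change g (e + a • v) = τ (e + a • v)
    rw [map_add, map_add, map_smul, map_smul, hgE e he, hτE e he, hτv]
  rw [← mul_inv_cancel_left τ g]
  exact N.mul_mem hτN (ih _ hlt (codisjoint_sup_span_singleton hB hE hv hvv)
    (mul_mem (inv_mem hτ) hg) hfix)

theorem isometryGroup_le_of_quasiReflection_mem : isometryGroup B ≤ N := fun _ hg =>
  mem_of_apply_eq_self_of_codisjoint hB hn hN (E := ⊥)
    (codisjoint_iff_le_sup.2 fun x _ => Submodule.mem_sup_right
      (Submodule.mem_orthogonalBilin_iff.2 fun e he => by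
        change B e x = 0
        rw [(Submodule.mem_bot ℂ).1 he, map_zero, LinearMap.zero_apply]))
    hg fun e he => by rw [(Submodule.mem_bot ℂ).1 he, map_zero]

end

end CartanDieudonne

section SymplecticTransvections

variable {V : Type*} [AddCommGroup V] [Module ℂ V] {Q : V →ₗ[ℂ] V →ₗ[ℂ] ℂ}

theorem form_rankOnePerturbation_apply_of_isAlt (hQ : Q.IsAlt) (c : ℂ) (δ x y : V) :
    Q (rankOnePerturbation Q c δ x) (rankOnePerturbation Q c δ y) = Q x y := by
  simp only [rankOnePerturbation_apply, map_add, LinearMap.add_apply, map_smul,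
    LinearMap.smul_apply, smul_eq_mul, hQ δ, ← hQ.neg y δ]
  ring

theorem form_sub_eq_zero_of_apply_eq_self {g : V ≃ₗ[ℂ] V} (hg : g ∈ isometryGroup Q) {f : V}
    (hf : g f = f) (x : V) : Q f (g x - x) = 0 := by
  rw [map_sub, sub_eq_zero, ← hg f x, hf]

variable [FiniteDimensional ℂ V]

theorem exists_transvection_mem (hQ : Q.IsAlt) (hn : Q.Nondegenerate)
    {N : Subgroup (V ≃ₗ[ℂ] V)}
    (hN : ∀ g ∈ isometryGroup Q, ∀ c w, (g : V →ₗ[ℂ] V) = rankOnePerturbation Q c w → g ∈ N)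
    (c : ℂ) (w : V) : ∃ τ ∈ isometryGroup Q ⊓ N, ∀ x, τ x = x + (c * Q x w) • w := by
  obtain ⟨τ, hτ, hτw⟩ := exists_mem_isometryGroup hn
    (form_rankOnePerturbation_apply_of_isAlt hQ c w)
  exact ⟨τ, ⟨hτ, hN τ hτ c w hτw⟩, LinearMap.congr_fun hτw⟩

section

variable {N : Subgroup (V ≃ₗ[ℂ] V)} (hQ : Q.IsAlt) (hn : Q.Nondegenerate)
  (hN : ∀ g ∈ isometryGroup Q, ∀ c w, (g : V →ₗ[ℂ] V) = rankOnePerturbation Q c w → g ∈ N)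
include hQ hn hN

theorem exists_fixedSubmodule_lt_of_form_apply_ne_zero {g : V ≃ₗ[ℂ] V}
    (hg : g ∈ isometryGroup Q) {x : V} (hx : Q x (g x) ≠ 0) :
    ∃ τ ∈ isometryGroup Q ⊓ N,
      (g : V →ₗ[ℂ] V).fixedSubmodule < ((τ * g : V ≃ₗ[ℂ] V) : V →ₗ[ℂ] V).fixedSubmodule := by
  obtain ⟨τ, hτ, hτw⟩ := exists_transvection_mem hQ hn hN (Q x (g x))⁻¹ (g x - x)
  have hτx : τ x = g x := by
    rw [hτw, map_sub, hQ x, sub_zero, inv_mul_cancel₀ hx, one_smul, add_sub_cancel]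
  refine ⟨τ⁻¹, inv_mem hτ, SetLike.lt_iff_le_and_exists.2 ⟨fun f hf => ?_, x, ?_, fun h => ?_⟩⟩
  · have hgf : g f = f := LinearMap.mem_fixedSubmodule_iff.1 hf
    refine LinearMap.mem_fixedSubmodule_iff.2 (τ.symm_apply_eq.2 ?_)
    change g f = τ f
    rw [hτw, form_sub_eq_zero_of_apply_eq_self hg hgf, mul_zero, zero_smul, add_zero, hgf]
  · exact LinearMap.mem_fixedSubmodule_iff.2 (τ.symm_apply_eq.2 hτx.symm)
  · exact hx (by rw [show g x = x from LinearMap.mem_fixedSubmodule_iff.1 h, hQ x])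

/-- Here `g` is an involution, because `Q x (g y)` is symmetric in `x` and `y`. -/
theorem exists_form_apply_ne_zero_of_forall_form_apply_eq_zero {g : V ≃ₗ[ℂ] V}
    (hg : g ∈ isometryGroup Q) (hgQ : ∀ x, Q x (g x) = 0) (hg1 : g ≠ 1) :
    ∃ τ ∈ isometryGroup Q ⊓ N,
      (g : V →ₗ[ℂ] V).fixedSubmodule ≤ ((τ * g : V ≃ₗ[ℂ] V) : V →ₗ[ℂ] V).fixedSubmodule ∧
        ∃ x, Q x ((τ * g) x) ≠ 0 := by
  have hsymm : ∀ x y, Q x (g y) = Q (g x) y := fun x y => by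
    have h := hgQ (x + y)
    simp only [map_add, LinearMap.add_apply, hgQ, zero_add, add_zero] at h
    rw [← hQ.neg y (g x)]
    linear_combination h
  have hinvol : ∀ x, g (g x) = x := fun x => sub_eq_zero.1 (hn.2 _ fun y => by
    rw [map_sub, hsymm, hg y x, sub_self])
  obtain ⟨z, hz⟩ : ∃ z, g z ≠ z := by
    by_contra! h
    exact hg1 (LinearEquiv.ext h)
  obtain ⟨x, hx⟩ : ∃ x, Q x (g z - z) ≠ 0 := by
    by_contra! h
    exact hz (sub_eq_zero.1 (hn.2 _ h))
  obtain ⟨τ, hτ, hτw⟩ := exists_transvection_mem hQ hn hN 1 (g z - z)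
  refine ⟨τ, hτ, fun f hf => ?_, x, ?_⟩
  · have hgf : g f = f := LinearMap.mem_fixedSubmodule_iff.1 hf
    refine LinearMap.mem_fixedSubmodule_iff.2 ?_
    rw [LinearEquiv.coe_coe, LinearEquiv.mul_apply, hgf, hτw,
      form_sub_eq_zero_of_apply_eq_self hg hgf, mul_zero, zero_smul, add_zero]
  · have hneg : Q (g x) (g z - z) = -Q x (g z - z) := by
      rw [← hsymm, map_sub, hinvol, map_sub, map_sub, neg_sub]
    rw [LinearEquiv.mul_apply, hτw, map_add, hgQ, zero_add, map_smul, smul_eq_mul, one_mul, hneg]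
    exact mul_ne_zero (neg_ne_zero.2 hx) hx

theorem isometryGroup_le_of_transvection_mem : isometryGroup Q ≤ N := by
  suffices h : ∀ F : Submodule ℂ V, ∀ g ∈ isometryGroup Q,
      (g : V →ₗ[ℂ] V).fixedSubmodule = F → g ∈ N from fun g hg => h _ g hg rfl
  intro F
  induction F using WellFoundedGT.induction with
  | ind F ih =>
  rintro g hg rfl
  by_cases hg1 : g = 1
  · exact hg1 ▸ N.one_mem
  obtain ⟨τ, hτ, hlt⟩ : ∃ τ ∈ isometryGroup Q ⊓ N,
      (g : V →ₗ[ℂ] V).fixedSubmodule < ((τ * g : V ≃ₗ[ℂ] V) : V →ₗ[ℂ] V).fixedSubmodule := by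
    by_cases hgQ : ∃ x, Q x (g x) ≠ 0
    · obtain ⟨x, hx⟩ := hgQ
      exact exists_fixedSubmodule_lt_of_form_apply_ne_zero hQ hn hN hg hx
    · push Not at hgQ
      obtain ⟨τ, hτ, hle, x, hx⟩ :=
        exists_form_apply_ne_zero_of_forall_form_apply_eq_zero hQ hn hN hg hgQ hg1
      obtain ⟨τ', hτ', hlt⟩ := exists_fixedSubmodule_lt_of_form_apply_ne_zero hQ hn hN
        (mul_mem hτ.1 hg) hx
      exact ⟨τ' * τ, mul_mem hτ' hτ, mul_assoc τ' τ g ▸ hle.trans_lt hlt⟩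
  exact (N.mul_mem_cancel_left hτ.2).1 (ih _ hlt _ (mul_mem hτ.1 hg) rfl)

end

end SymplecticTransvections

section RankOneEndomorphisms

variable {V : Type*} [AddCommGroup V] [Module ℂ V] {σ : ℂ →+* ℂ} {B : V →ₗ[ℂ] V →ₛₗ[σ] ℂ}

/-- The endomorphism `x ↦ B(x, a) b`. -/
def formTensor (B : V →ₗ[ℂ] V →ₛₗ[σ] ℂ) (a b : V) : Module.End ℂ V :=
  (B.flip a).smulRight b

theorem formTensor_apply (a b x : V) : formTensor B a b x = B x a • b := rfl

/-- The endomorphism `x ↦ B(x, a) b - B(x, b) a`, an infinitesimal rotation in the plane of `a`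
and `b`. -/
def formWedge (B : V →ₗ[ℂ] V →ₛₗ[σ] ℂ) (a b : V) : Module.End ℂ V :=
  formTensor B a b - formTensor B b a

theorem formWedge_apply (a b x : V) : formWedge B a b x = B x a • b - B x b • a := rfl

theorem formWedge_add (a b c : V) :
    formWedge B a (b + c) = formWedge B a b + formWedge B a c := by
  ext x
  simp only [formWedge_apply, LinearMap.add_apply, map_add]
  module

theorem formWedge_smul_of_apply_eq {z : ℂ} (hz : σ z = z) (a b : V) :
    formWedge B a (z • b) = z • formWedge B a b := by
  ext x
  simp only [formWedge_apply, LinearMap.map_smulₛₗ, hz, LinearMap.smul_apply, smul_eq_mul]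
  module

/-- The component of `x` orthogonal to `δ`; it is meaningful when `B(δ, δ) ≠ 0`. -/
noncomputable def orthComponent (B : V →ₗ[ℂ] V →ₛₗ[σ] ℂ) (δ x : V) : V :=
  x - (B x δ / B δ δ) • δ

theorem form_orthComponent_apply_self {δ : V} (hδ : B δ δ ≠ 0) (x : V) :
    B (orthComponent B δ x) δ = 0 := by
  rw [orthComponent, map_sub, LinearMap.sub_apply, map_smul, LinearMap.smul_apply, smul_eq_mul,
    div_mul_cancel₀ _ hδ, sub_self]

theorem orthComponent_of_orth {δ x : V} (h : B x δ = 0) : orthComponent B δ x = x := by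
  rw [orthComponent, h, zero_div, zero_smul, sub_zero]

theorem mem_span_singleton_sup_of_orthComponent_mem {δ x : V} {D : Submodule ℂ V}
    (h : orthComponent B δ x ∈ D) : x ∈ Submodule.span ℂ {δ} ⊔ D := by
  rw [← add_sub_cancel ((B x δ / B δ δ) • δ) x]
  exact Submodule.add_mem_sup (Submodule.smul_mem _ _ (Submodule.mem_span_singleton_self δ)) h

theorem conj_rankOnePerturbation (hB : ∀ x y, B x y = σ (B y x)) {X : Module.End ℂ V}
    (hX : ∀ x y, B (X x) y = -B x (X y)) {c : ℂ} {δ : V} (hδ : B δ δ ≠ 0) (hσc : σ (σ c) = c)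
    (hc : c + σ c + c * σ c * B δ δ = 0) :
    rankOnePerturbation B c δ * X * rankOnePerturbation B (σ c) δ =
      X + formWedge B δ (σ c • orthComponent B δ (X δ)) := by
  have hskew : σ (B (X δ) δ) = -B (X δ) δ := by rw [← hB, hX δ δ, neg_neg]
  obtain ⟨q, hq⟩ : ∃ q, B (X δ) δ = q * B δ δ := ⟨_, (div_mul_cancel₀ _ hδ).symm⟩
  ext x
  simp only [Module.End.mul_apply, rankOnePerturbation_apply, LinearMap.add_apply, orthComponent,
    formWedge_apply, map_add, map_sub, map_smul, LinearMap.map_smulₛₗ,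
    smul_eq_mul, hX x δ, hσc, map_div₀, hskew, ← hB δ δ]
  rw [hq, neg_div, mul_div_cancel_right₀ _ hδ]
  linear_combination (norm := module) (B x δ * q * hc) • δ

theorem coe_inv_eq_rankOnePerturbation (hB : ∀ x y, B x y = σ (B y x)) (hn : B.Nondegenerate)
    {s : V ≃ₗ[ℂ] V} (hs : s ∈ isometryGroup B) {c : ℂ} {δ : V}
    (hsδ : (s : V →ₗ[ℂ] V) = rankOnePerturbation B c δ) :
    ((s⁻¹ : V ≃ₗ[ℂ] V) : V →ₗ[ℂ] V) = rankOnePerturbation B (σ c) δ := by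
  ext x
  refine sub_eq_zero.1 (hn.1 _ fun y => ?_)
  have hadj : B ((s⁻¹ : V ≃ₗ[ℂ] V) x) y = B x (s y) := by
    rw [← hs, show s ((s⁻¹ : V ≃ₗ[ℂ] V) x) = x from s.apply_symm_apply x]
  rw [map_sub, LinearMap.sub_apply, sub_eq_zero, LinearEquiv.coe_coe, hadj,
    ← LinearEquiv.coe_coe s, hsδ]
  simp only [rankOnePerturbation_apply, map_add, LinearMap.add_apply, LinearMap.map_smulₛₗ,
    map_mul, ← hB δ y, map_smul, LinearMap.smul_apply, smul_eq_mul]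
  ring

end RankOneEndomorphisms

section RotationSpace

variable {V : Type*} [AddCommGroup V] [Module ℂ V] {σ : ℂ →+* ℂ} {B : V →ₗ[ℂ] V →ₛₗ[σ] ℂ}

/-- The vectors `v` orthogonal to `δ` such that `L` contains the infinitesimal rotations of `δ`
towards all the complex multiples of `v`. The multiples are part of the condition because `L` is
only a real subspace. -/
def rotationSpace (B : V →ₗ[ℂ] V →ₛₗ[σ] ℂ) (L : Submodule ℝ (Module.End ℂ V)) (δ : V) :
    Submodule ℂ V where
  carrier := {v | B δ v = 0 ∧ ∀ z : ℂ, formWedge B δ (z • v) ∈ L}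
  zero_mem' := ⟨map_zero _, fun z => by
    rw [show formWedge B δ (z • 0) = 0 from LinearMap.ext fun x => by simp [formWedge_apply]]
    exact L.zero_mem⟩
  add_mem' := fun {u v} hu hv => ⟨by rw [map_add, hu.1, hv.1, add_zero], fun z => by
    rw [smul_add, formWedge_add]
    exact L.add_mem (hu.2 z) (hv.2 z)⟩
  smul_mem' := fun a v hv => ⟨by rw [LinearMap.map_smulₛₗ, hv.1, smul_zero], fun z => by
    rw [smul_smul]
    exact hv.2 _⟩

variable {L : Submodule ℝ (Module.End ℂ V)}

theorem formWedge_mem_of_mem_rotationSpace {δ v : V} (hv : v ∈ rotationSpace B L δ) :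
    formWedge B δ v ∈ L := by
  simpa only [one_smul] using hv.2 1

section

variable {R : Set V} (hB : ∀ x y, B x y = σ (B y x)) (hR : ∀ δ ∈ R, B δ δ ≠ 0)
  (hL : ∀ X ∈ L, ∀ δ ∈ R, orthComponent B δ (X δ) ∈ rotationSpace B L δ)

include hL in
theorem formWedge_apply_mem_rotationSpace {δ δ' v : V} (hδ' : δ' ∈ R)
    (hv : v ∈ rotationSpace B L δ) (horth : B (formWedge B δ v δ') δ' = 0) :
    formWedge B δ v δ' ∈ rotationSpace B L δ' := by
  rw [← orthComponent_of_orth horth]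
  exact hL _ (formWedge_mem_of_mem_rotationSpace hv) δ' hδ'

include hB in
theorem exists_mem_form_formWedge_apply_eq_zero (hσ : ∀ z, σ (σ z) = z) {δ δ' v : V}
    {D : Submodule ℂ V} (hv : v ∈ D) (hne : B δ' v ≠ 0) :
    ∃ u ∈ D, B δ' u ≠ 0 ∧ B (formWedge B δ u δ') δ' = 0 := by
  simp only [formWedge_apply, map_sub, LinearMap.sub_apply, map_smul, LinearMap.smul_apply,
    smul_eq_mul]
  by_cases hδ' : B δ' δ = 0
  · exact ⟨v, hv, hne, by rw [hδ', form_eq_zero_symm hB hδ', zero_mul, mul_zero, sub_zero]⟩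
  · have hu : B δ' (σ (B δ' δ / B δ' v) • v) = B δ' δ := by
      rw [LinearMap.map_smulₛₗ, hσ, smul_eq_mul, div_mul_cancel₀ _ hne]
    exact ⟨_, D.smul_mem _ hv, hu.symm ▸ hδ', by rw [hB _ δ', hu, hB δ δ', sub_self]⟩

include hB hR hL

/-- The rotation in the plane of `δ` and `v` sends `δ'` to some `w`, and the rotation in the plane
of `δ'` and `w` sends `δ` back to a vector that involves `δ'`. -/
theorem mem_span_singleton_sup_rotationSpace (hσ : ∀ z, σ (σ z) = z) {δ δ' v : V} (hδ : δ ∈ R)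
    (hδ' : δ' ∈ R) (hv : v ∈ rotationSpace B L δ) (hne : B δ' v ≠ 0) :
    δ' ∈ Submodule.span ℂ {δ} ⊔ rotationSpace B L δ := by
  obtain ⟨u, hu, hne, horth⟩ := exists_mem_form_formWedge_apply_eq_zero hB hσ (δ := δ) hv hne
  have hw := formWedge_apply_mem_rotationSpace hL hδ' hu horth
  set U := Submodule.span ℂ {δ} ⊔ rotationSpace B L δ
  have hδU : δ ∈ U := Submodule.mem_sup_left (Submodule.mem_span_singleton_self δ)
  have hwU : formWedge B δ u δ' ∈ U :=
    sub_mem (U.smul_mem _ (Submodule.mem_sup_right hu)) (U.smul_mem _ hδU)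
  have hδw : B δ (formWedge B δ u δ') ≠ 0 := by
    rw [formWedge_apply, map_sub, LinearMap.map_smulₛₗ, LinearMap.map_smulₛₗ, hu.1, smul_zero,
      zero_sub, smul_eq_mul]
    exact neg_ne_zero.2 (mul_ne_zero ((map_ne_zero σ).2 hne) (hR δ hδ))
  have hback : formWedge B δ' (formWedge B δ u δ') δ ∈ U :=
    mem_span_singleton_sup_of_orthComponent_mem
      (hL _ (formWedge_mem_of_mem_rotationSpace hw) δ hδ)
  rw [formWedge_apply] at hback
  exact (U.smul_mem_iff hδw).1 ((U.sub_mem_iff_right (U.smul_mem _ hwU)).1 hback)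

theorem isotropic_of_mem_rotationSpace (hLie : ∀ X ∈ L, ∀ Y ∈ L, ⁅X, Y⁆ ∈ L) {δ δ' v : V}
    (hδ : δ ∈ R) (hδ' : δ' ∈ R) (hv : v ∈ rotationSpace B L δ) (hδ'v : B δ' v = 0)
    (hne : B δ' δ ≠ 0) (hnot : δ' ∉ Submodule.span ℂ {δ} ⊔ rotationSpace B L δ) :
    B v v = 0 := by
  by_contra hvv
  have hvδ' : B v δ' = 0 := form_eq_zero_symm hB hδ'v
  have hvδ : B v δ = 0 := form_eq_zero_symm hB hv.1
  have hv' : v ∈ rotationSpace B L δ' := by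
    have hrot : formWedge B δ v δ' = B δ' δ • v := by
      rw [formWedge_apply, hδ'v, zero_smul, sub_zero]
    rw [← Submodule.smul_mem_iff _ hne, ← hrot]
    exact formWedge_apply_mem_rotationSpace hL hδ' hv (by
      rw [hrot, map_smul, LinearMap.smul_apply, hvδ', smul_zero])
  have hlie : ⁅formWedge B δ v, formWedge B δ' v⁆ δ =
      (B δ δ * B v v) • δ' - (B δ δ' * B v v) • δ := by
    simp only [Ring.lie_def, LinearMap.sub_apply, Module.End.mul_apply, formWedge_apply, map_smul,
      hv.1, hvδ, hvδ', zero_smul, sub_zero, zero_sub, smul_neg, smul_smul]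
    module
  set U := Submodule.span ℂ {δ} ⊔ rotationSpace B L δ
  have hδU : δ ∈ U := Submodule.mem_sup_left (Submodule.mem_span_singleton_self δ)
  have hmem : ⁅formWedge B δ v, formWedge B δ' v⁆ δ ∈ U :=
    mem_span_singleton_sup_of_orthComponent_mem (hL _ (hLie _
      (formWedge_mem_of_mem_rotationSpace hv) _ (formWedge_mem_of_mem_rotationSpace hv')) δ hδ)
  rw [hlie, U.sub_mem_iff_left (U.smul_mem _ hδU)] at hmem
  exact hnot ((U.smul_mem_iff (mul_ne_zero (hR δ hδ) hvv)).1 hmem)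

theorem formWedge_mem_of_orthComponent_ne_zero (hn : B.Nondegenerate) (hσ : ∀ z, σ (σ z) = z)
    (hLie : ∀ X ∈ L, ∀ Y ∈ L, ⁅X, Y⁆ ∈ L) (hspan : Submodule.span ℂ R = ⊤)
    (hsplit : ∀ U : Submodule ℂ V, U ≠ ⊥ →
      R ⊆ (U : Set V) ∪ (U.orthogonalBilin B : Set V) → U = ⊤)
    {X : Module.End ℂ V} (hX : X ∈ L) {δ : V} (hδ : δ ∈ R) (hXδ : orthComponent B δ (X δ) ≠ 0)
    {v : V} (hv : B δ v = 0) : formWedge B δ v ∈ L := by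
  have hD : rotationSpace B L δ ≠ ⊥ := (Submodule.ne_bot_iff _).2 ⟨_, hL X hX δ hδ, hXδ⟩
  have horth : ∀ r ∈ R, r ∉ Submodule.span ℂ {δ} ⊔ rotationSpace B L δ →
      ∀ u ∈ rotationSpace B L δ, B r u = 0 := fun r hr hnot u hu => not_not.1 fun hne =>
    hnot (mem_span_singleton_sup_rotationSpace hB hR hL hσ hδ hr hu hne)
  have htop : Submodule.span ℂ {δ} ⊔ rotationSpace B L δ = ⊤ :=
    hsplit _ (fun h => hD (le_bot_iff.1 (h ▸ le_sup_right)))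
      (subset_union_orthogonalBilin_span_singleton_sup hB hn hspan hD (fun u hu => hu.1) horth
        fun r hr hnot hne u hu => isotropic_of_mem_rotationSpace hB hR hL hLie hδ hr hu
          (horth r hr hnot u hu) hne hnot)
  obtain ⟨y, hy, d, hd, rfl⟩ := Submodule.mem_sup.1 (htop ▸ Submodule.mem_top : v ∈ _)
  obtain ⟨a, rfl⟩ := Submodule.mem_span_singleton.1 hy
  rw [map_add, LinearMap.map_smulₛₗ, hd.1, add_zero, smul_eq_mul, mul_eq_zero, map_eq_zero] at hv
  rw [hv.resolve_right (hR δ hδ), zero_smul, zero_add]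
  exact formWedge_mem_of_mem_rotationSpace hd

end

end RotationSpace

section LieAlgebraOfIsometries

variable {V : Type*} [AddCommGroup V] [Module ℂ V] [FiniteDimensional ℂ V] {σ : ℂ →+* ℂ}
  {B : V →ₗ[ℂ] V →ₛₗ[σ] ℂ} {M : Subgroup (V ≃ₗ[ℂ] V)} (hM : IsAlgebraicSubgroup ℝ M)

theorem mem_of_apply_eq_add_of_sq_zero {X : Module.End ℂ V} (hX : X ∈ hM.lieAlgebra)
    (hXX : ∀ x, X (X x) = 0) {g : V ≃ₗ[ℂ] V} (hg : ∀ x, g x = x + X x) : g ∈ M := by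
  obtain ⟨m, hm, -, hmX⟩ := hM.exists_exp_mem hX
  rwa [show g = m from LinearEquiv.ext fun x => by rw [hg, hmX x (hXX x)]]

variable (hMB : M ≤ isometryGroup B) (hB : ∀ x y, B x y = σ (B y x)) (hn : B.Nondegenerate)
  (hσ : ∀ z, σ (σ z) = z) (hσℝ : ∀ r : ℝ, σ r = r) {c : ℂ} {δ : V} (hδ : B δ δ ≠ 0)
  (hc : c + σ c + c * σ c * B δ δ = 0)
  (hMδ : ∃ s ∈ M, (s : V →ₗ[ℂ] V) = rankOnePerturbation B c δ)
include hMB hB hn hσ hσℝ hδ hc hMδ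

theorem formWedge_smul_orthComponent_mem {X : Module.End ℂ V} (hX : X ∈ hM.lieAlgebra) :
    formWedge B δ (σ c • orthComponent B δ (X δ)) ∈ hM.lieAlgebra := by
  obtain ⟨s, hs, hsδ⟩ := hMδ
  have hconj := hM.conj_mem_lieAlgebra hs hX
  rw [coe_inv_eq_rankOnePerturbation hB hn (hMB hs) hsδ, hsδ, conj_rankOnePerturbation hB
    (hM.skew_of_mem_lieAlgebra hσℝ hMB hX) hδ (hσ c) hc] at hconj
  exact (hM.lieAlgebra.add_mem_iff_right hX).1 hconj

theorem orthComponent_mem_rotationSpace (hc0 : c ≠ 0)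
    (hscale : ∀ v, B δ v = 0 → formWedge B δ v ∈ hM.lieAlgebra →
      ∀ z : ℂ, formWedge B δ (z • v) ∈ hM.lieAlgebra)
    {X : Module.End ℂ V} (hX : X ∈ hM.lieAlgebra) :
    orthComponent B δ (X δ) ∈ rotationSpace B hM.lieAlgebra δ := by
  have horth : B δ (orthComponent B δ (X δ)) = 0 :=
    form_eq_zero_symm hB (form_orthComponent_apply_self hδ _)
  refine ⟨horth, fun z => ?_⟩
  have hmem := hscale _ (by rw [LinearMap.map_smulₛₗ, horth, smul_zero])
    (formWedge_smul_orthComponent_mem hM hMB hB hn hσ hσℝ hδ hc hMδ hX) (z * (σ c)⁻¹)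
  rwa [smul_smul, mul_assoc, inv_mul_cancel₀ ((map_ne_zero σ).2 hc0), mul_one] at hmem

end LieAlgebraOfIsometries

section Symplectic

variable {V : Type*} [AddCommGroup V] [Module ℂ V] {Q : V →ₗ[ℂ] V →ₗ[ℂ] ℂ}

/-- The endomorphism `x ↦ Q(x, a) b + Q(x, b) a`, as a bilinear map in `a` and `b`; it is twice
`formTensor Q a a` for `b = a`. -/
def formSymm (Q : V →ₗ[ℂ] V →ₗ[ℂ] ℂ) : V →ₗ[ℂ] V →ₗ[ℂ] Module.End ℂ V :=
  LinearMap.mk₂ ℂ (fun a b => formTensor Q a b + formTensor Q b a)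
    (fun a a' b => LinearMap.ext fun x => by
      simp only [formTensor_apply, LinearMap.add_apply, map_add]
      module)
    (fun z a b => LinearMap.ext fun x => by
      simp only [formTensor_apply, LinearMap.add_apply, map_smul, LinearMap.smul_apply, smul_eq_mul]
      module)
    (fun a b b' => LinearMap.ext fun x => by
      simp only [formTensor_apply, LinearMap.add_apply, map_add]
      module)
    (fun z a b => LinearMap.ext fun x => by
      simp only [formTensor_apply, LinearMap.add_apply, map_smul, LinearMap.smul_apply, smul_eq_mul]
      module)

theorem formSymm_apply (a b x : V) : formSymm Q a b x = Q x a • b + Q x b • a := rfl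

theorem formSymm_self (a : V) : formSymm Q a a = (2 : ℂ) • formTensor Q a a :=
  (two_smul ℂ _).symm

theorem formSymm_comm (a b : V) : formSymm Q a b = formSymm Q b a :=
  add_comm _ _

theorem lie_formTensor_self {X : Module.End ℂ V} (hX : ∀ x y, Q (X x) y = -Q x (X y)) (δ : V) :
    ⁅X, formTensor Q δ δ⁆ = formSymm Q δ (X δ) := by
  ext x
  simp only [Ring.lie_def, LinearMap.sub_apply, Module.End.mul_apply, formTensor_apply, hX x δ,
    formSymm_apply, map_smul]
  module

section

variable {L : Submodule ℂ (Module.End ℂ V)} {R : Set V} (hQ : Q.IsAlt)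
  (hskew : ∀ X ∈ L, ∀ x y, Q (X x) y = -Q x (X y)) (hLie : ∀ X ∈ L, ∀ Y ∈ L, ⁅X, Y⁆ ∈ L)
  (hRL : ∀ δ ∈ R, formTensor Q δ δ ∈ L)
include hskew hLie hRL

theorem formSymm_apply_mem {X : Module.End ℂ V} (hX : X ∈ L) {δ : V} (hδ : δ ∈ R) :
    formSymm Q δ (X δ) ∈ L :=
  lie_formTensor_self (hskew X hX) δ ▸ hLie X hX _ (hRL δ hδ)

theorem formSymm_mem_of_form_ne_zero {δ δ' : V} (hδ : δ ∈ R) (hδ' : δ' ∈ R) {v : V}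
    (hv : formSymm Q δ v ∈ L) (hne : Q δ' v ≠ 0) : formSymm Q δ δ' ∈ L := by
  rw [formSymm_comm]
  by_cases hδδ' : Q δ' δ = 0
  · have hmem := formSymm_apply_mem hskew hLie hRL hv hδ'
    rw [formSymm_apply, hδδ', zero_smul, zero_add, map_smul] at hmem
    exact (L.smul_mem_iff hne).1 hmem
  · have hmem := formSymm_apply_mem hskew hLie hRL (hRL δ hδ) hδ'
    rw [formTensor_apply, map_smul] at hmem
    exact (L.smul_mem_iff hδδ').1 hmem

include hQ in
theorem formSymm_mem (hspan : Submodule.span ℂ R = ⊤)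
    (hsplit : ∀ U : Submodule ℂ V, U ≠ ⊥ →
      R ⊆ (U : Set V) ∪ (U.orthogonalBilin Q : Set V) → U = ⊤) (a b : V) :
    formSymm Q a b ∈ L := by
  have hR : ∀ δ ∈ R, formSymm Q δ b ∈ L := fun δ hδ => by
    by_cases hδ0 : δ = 0
    · rw [hδ0, map_zero, LinearMap.zero_apply]
      exact L.zero_mem
    have hδL : δ ∈ L.comap (formSymm Q δ) := by
      rw [Submodule.mem_comap, formSymm_self]
      exact L.smul_mem _ (hRL δ hδ)
    have htop : L.comap (formSymm Q δ) = ⊤ :=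
      hsplit _ ((Submodule.ne_bot_iff _).2 ⟨δ, hδL, hδ0⟩) fun δ' hδ' =>
        or_iff_not_imp_left.2 fun hnot => Submodule.mem_orthogonalBilin_iff.2 fun v hv =>
          hQ.isRefl _ _ (not_not.1 fun hne =>
            hnot (formSymm_mem_of_form_ne_zero hskew hLie hRL hδ hδ' hv hne))
    exact (htop ▸ Submodule.mem_top : b ∈ L.comap (formSymm Q δ))
  have hle : Submodule.span ℂ R ≤ L.comap ((formSymm Q).flip b) := Submodule.span_le.2 hR
  exact hle (hspan ▸ Submodule.mem_top : a ∈ Submodule.span ℂ R)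

end

theorem coe_pow_eq_rankOnePerturbation {δ : V} (hδ : Q δ δ = 0) {c : ℂ} {g : V ≃ₗ[ℂ] V}
    (hg : (g : V →ₗ[ℂ] V) = rankOnePerturbation Q c δ) (n : ℕ) :
    ((g ^ n : V ≃ₗ[ℂ] V) : V →ₗ[ℂ] V) = rankOnePerturbation Q (n * c) δ := by
  ext x
  rw [LinearEquiv.coe_coe, rankOnePerturbation_apply]
  induction n generalizing x with
  | zero => rw [Nat.cast_zero, zero_mul, zero_mul, zero_smul, add_zero]; rfl
  | succ n ih =>
    rw [pow_succ, LinearEquiv.mul_apply, ← LinearEquiv.coe_coe g, hg, ih,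
      rankOnePerturbation_apply, map_add, LinearMap.add_apply, map_smul, LinearMap.smul_apply, hδ,
      smul_zero, add_zero, Nat.cast_succ]
    module

theorem rankOnePerturbation_eq_one_add (c : ℂ) (δ : V) :
    rankOnePerturbation Q c δ = 1 + c • formTensor Q δ δ := by
  ext x
  rw [rankOnePerturbation_apply, mul_smul]
  rfl

variable [FiniteDimensional ℂ V] {M : Subgroup (V ≃ₗ[ℂ] V)}

theorem formTensor_self_mem_lieAlgebra (hQ : Q.IsAlt) (hn : Q.Nondegenerate)
    (hM : IsAlgebraicSubgroup ℂ M) {c : ℂ} (hc : c ≠ 0) {δ : V}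
    (hδ : ∃ g ∈ M, (g : V →ₗ[ℂ] V) = rankOnePerturbation Q c δ) :
    formTensor Q δ δ ∈ hM.real_of_complex.lieAlgebra := by
  obtain ⟨g, hg, hgδ⟩ := hδ
  obtain ⟨Z, hZ, hMZ⟩ := hM
  have hline : ∀ t : ℂ, 1 + t • c • formTensor Q δ δ ∈ Z := fun t => hZ.line_mem (fun n => by
    rw [smul_smul, ← rankOnePerturbation_eq_one_add, ← coe_pow_eq_rankOnePerturbation (hQ δ) hgδ]
    exact (hMZ _).1 (pow_mem hg n)) t
  refine IsAlgebraicSubgroup.mem_lieAlgebra_of_line _ fun t => ?_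
  obtain ⟨τ, -, hτ⟩ := exists_mem_isometryGroup hn
    (form_rankOnePerturbation_apply_of_isAlt hQ t δ)
  rw [rankOnePerturbation_eq_one_add, Complex.coe_smul] at hτ
  refine ⟨τ, (hMZ τ).2 ?_, hτ⟩
  rw [hτ, ← Complex.coe_smul]
  simpa only [smul_smul, div_mul_cancel₀ _ hc] using hline (t / c)

theorem isometryGroup_le_of_formSymm_mem (hQ : Q.IsAlt) (hn : Q.Nondegenerate)
    (hM : IsAlgebraicSubgroup ℝ M) (hsymm : ∀ a b, formSymm Q a b ∈ hM.lieAlgebra) :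
    isometryGroup Q ≤ M :=
  isometryGroup_le_of_transvection_mem hQ hn fun g _ c w hg =>
    mem_of_apply_eq_add_of_sq_zero hM (hsymm ((c / 2) • w) w)
      (fun x => by simp [formSymm_apply, hQ w]) fun x => by
      rw [← LinearEquiv.coe_coe, hg, rankOnePerturbation_apply, formSymm_apply, map_smul,
        smul_eq_mul]
      module

theorem splitsOrthogonally_or_eq_isometryGroup_of_isAlt {R : Set V} {c : ℂ} (hc : c ≠ 0)
    (hQ : Q.IsAlt) (hn : Q.Nondegenerate) (hspan : Submodule.span ℂ R = ⊤)
    (hM : IsLeast (algebraicSubgroupsContaining ℂ (isometryGroup Q)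
      (rankOnePerturbation Q c '' R)) M) :
    SplitsOrthogonally Q M R ∨ M = isometryGroup Q := by
  obtain ⟨hMQ, hMalg, hMR⟩ := hM.1
  refine or_iff_not_imp_left.2 fun hnot => le_antisymm hMQ ?_
  let L : Submodule ℂ (Module.End ℂ V) :=
    { hMalg.real_of_complex.lieAlgebra with
      smul_mem' := fun z _ hX => hMalg.real_of_complex.smul_mem_lieAlgebra hMalg z hX }
  refine isometryGroup_le_of_formSymm_mem hQ hn hMalg.real_of_complex
    (formSymm_mem (L := L) hQ
      (fun X hX => hMalg.real_of_complex.skew_of_mem_lieAlgebra (fun _ => rfl) hMQ hX)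
      (fun X hX Y hY => hMalg.real_of_complex.lie_mem_lieAlgebra hX hY)
      (fun δ hδ => formTensor_self_mem_lieAlgebra hQ hn hMalg hc (hMR _ ⟨δ, hδ, rfl⟩)) hspan
      fun U hU hRU => ?_)
  by_contra htop
  exact hnot (splitsOrthogonally_of_subset hM (isAlgebraicSubgroup_stabilizer_submodule U) hU htop
    hRU)

end Symplectic

section RankOneIsometries

variable {V : Type*} [AddCommGroup V] [Module ℂ V] {σ : ℂ →+* ℂ} {B : V →ₗ[ℂ] V →ₛₗ[σ] ℂ}

theorem rankOnePerturbation_smul (c z : ℂ) (δ : V) :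
    rankOnePerturbation B c (z • δ) = rankOnePerturbation B (c * σ z * z) δ := by
  ext x
  simp only [rankOnePerturbation_apply, LinearMap.map_smulₛₗ, smul_eq_mul, smul_smul]
  ring_nf

theorem coe_conj_eq_rankOnePerturbation {m s : V ≃ₗ[ℂ] V} (hm : m ∈ isometryGroup B) {c : ℂ}
    {δ : V} (hs : (s : V →ₗ[ℂ] V) = rankOnePerturbation B c δ) :
    ((m * s * m⁻¹ : V ≃ₗ[ℂ] V) : V →ₗ[ℂ] V) = rankOnePerturbation B c (m δ) := by
  ext x
  have hx : m ((m⁻¹ : V ≃ₗ[ℂ] V) x) = x := m.apply_symm_apply x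
  rw [LinearEquiv.coe_coe, LinearEquiv.mul_apply, LinearEquiv.mul_apply, ← LinearEquiv.coe_coe s,
    hs, rankOnePerturbation_apply, rankOnePerturbation_apply, ← hm _ δ, map_add, map_smul, hx]

end RankOneIsometries

section Orthogonal

variable {V : Type*} [AddCommGroup V] [Module ℂ V] {Q : V →ₗ[ℂ] V →ₗ[ℂ] ℂ}

theorem form_apply_self_eq_zero_of_skew (hQ : ∀ x y, Q x y = Q y x) {X : Module.End ℂ V}
    (hX : ∀ x y, Q (X x) y = -Q x (X y)) (x : V) : Q (X x) x = 0 := by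
  have h := hX x x
  rw [hQ x] at h
  exact self_eq_neg.1 h

theorem eq_zero_or_mul_eq_neg_two_of_rankOnePerturbation_mem {g : V ≃ₗ[ℂ] V}
    (hg : g ∈ isometryGroup Q) {c : ℂ} {w : V} (hw : Q w w ≠ 0)
    (hgc : (g : V →ₗ[ℂ] V) = rankOnePerturbation Q c w) : c = 0 ∨ c * Q w w = -2 := by
  have happ : g w = (1 + c * Q w w) • w := by
    rw [← LinearEquiv.coe_coe, hgc, rankOnePerturbation_apply, add_smul, one_smul]
  have hnorm := hg w w
  rw [happ, map_smul, map_smul, LinearMap.smul_apply, smul_eq_mul, smul_eq_mul] at hnorm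
  have hfactor : c * (c * Q w w + 2) * Q w w ^ 2 = 0 := by linear_combination hnorm
  rw [mul_eq_zero, or_iff_left (pow_ne_zero 2 hw), mul_eq_zero] at hfactor
  exact hfactor.imp id eq_neg_of_add_eq_zero_left

variable [FiniteDimensional ℂ V] {M : Subgroup (V ≃ₗ[ℂ] V)} (hM : IsAlgebraicSubgroup ℝ M)

/-- The vectors `δ ∓ iu` are eigenvectors of `X` with eigenvalues `±iθ`. -/
theorem exists_mem_apply_eq_cos_smul_add_sin_smul {X : Module.End ℂ V} (hX : X ∈ hM.lieAlgebra)
    {δ u : V} {θ : ℂ} (hδ : X δ = θ • u) (hu : X u = -(θ • δ)) :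
    ∃ m ∈ M, m δ = Complex.cos θ • δ + Complex.sin θ • u := by
  obtain ⟨m, hm, hmX, -⟩ := hM.exists_exp_mem hX
  have heig (z : ℂ) (hz : z * z = -1) :
      m (δ - z • u) = (Complex.cos θ + Complex.sin θ * z) • (δ - z • u) := by
    have hexp : Complex.exp (θ * z) = Complex.cos θ + Complex.sin θ * z := by
      rcases mul_self_eq_mul_self_iff.1 (hz.trans Complex.I_mul_I.symm) with rfl | rfl
      · exact Complex.exp_mul_I θ
      · rw [mul_neg, ← neg_mul, Complex.exp_mul_I, Complex.cos_neg, Complex.sin_neg, neg_mul,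
          mul_neg]
    rw [← hexp]
    refine hmX _ _ ?_
    rw [map_sub, map_smul, hδ, hu]
    linear_combination (norm := module) (θ * hz) • u
  have hplus := heig Complex.I Complex.I_mul_I
  have hminus := heig (-Complex.I) (by rw [neg_mul_neg, Complex.I_mul_I])
  refine ⟨m, hm, smul_right_injective V (two_ne_zero (α := ℂ)) ?_⟩
  calc (2 : ℂ) • m δ = m (δ - Complex.I • u) + m (δ - -Complex.I • u) := by
        rw [← map_add, ← map_smul]
        congr 1
        module
    _ = (2 : ℂ) • (Complex.cos θ • δ + Complex.sin θ • u) := by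
        rw [hplus, hminus]
        linear_combination (norm := module) (-2 * Complex.sin θ * Complex.I_mul_I) • u

section

variable (hQ : ∀ x y, Q x y = Q y x) {δ w : V} (hδ : Q δ δ ≠ 0)
  (hall : ∀ v, Q δ v = 0 → formWedge Q δ v ∈ hM.lieAlgebra) (hw : Q w w = Q δ δ)
include hQ hδ hall hw

/-- The isometry is unipotent: `w - δ` is isotropic and orthogonal to `δ`. -/
theorem exists_mem_apply_eq_of_form_eq (hδw : Q δ w = Q δ δ) : ∃ m ∈ M, m δ = w := by
  have horth : Q δ (w - δ) = 0 := by rw [map_sub, hδw, sub_self]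
  have hiso : Q (w - δ) (w - δ) = 0 := by
    rw [map_sub Q, LinearMap.sub_apply, horth, sub_zero, map_sub, hw, hQ w, hδw, sub_self]
  obtain ⟨m, hm, -, hmX⟩ := hM.exists_exp_mem
    (hall ((Q δ δ)⁻¹ • (w - δ)) (by rw [map_smul, horth, smul_zero]))
  have hXδ : formWedge Q δ ((Q δ δ)⁻¹ • (w - δ)) δ = w - δ := by
    rw [formWedge_apply, map_smul, horth, smul_zero, zero_smul, sub_zero, smul_inv_smul₀ hδ]
  refine ⟨m, hm, ?_⟩
  rw [hmX δ, hXδ, add_sub_cancel]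
  rw [hXδ, formWedge_apply, map_smul, hiso, hQ, horth, zero_smul, smul_zero, zero_smul, sub_zero]

theorem exists_mem_apply_eq_of_sin_ne_zero {θ : ℂ} (hθ : Complex.cos θ * Q δ δ = Q δ w)
    (hs : Complex.sin θ ≠ 0) : ∃ m ∈ M, m δ = w := by
  have htrig := Complex.sin_sq_add_cos_sq θ
  obtain ⟨u, rfl⟩ : ∃ u, w = Complex.cos θ • δ + Complex.sin θ • u :=
    ⟨(Complex.sin θ)⁻¹ • (w - Complex.cos θ • δ), by rw [smul_inv_smul₀ hs, add_sub_cancel]⟩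
  have hδu : Q δ u = 0 := by
    rw [map_add, map_smul, map_smul, smul_eq_mul, smul_eq_mul, left_eq_add] at hθ
    exact (mul_eq_zero.1 hθ).resolve_left hs
  have huδ : Q u δ = 0 := (hQ u δ).trans hδu
  have huu : Q u u = Q δ δ := by
    simp only [map_add, LinearMap.add_apply, map_smul, LinearMap.smul_apply, smul_eq_mul, hδu,
      huδ] at hw
    exact mul_left_cancel₀ (pow_ne_zero 2 hs) (by linear_combination hw - Q δ δ * htrig)
  refine exists_mem_apply_eq_cos_smul_add_sin_smul hM
    (hall ((θ / Q δ δ) • u) (by rw [map_smul, hδu, smul_zero])) ?_ ?_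
  · rw [formWedge_apply, map_smul, hδu, smul_zero, zero_smul, sub_zero, smul_smul,
      mul_div_cancel₀ _ hδ]
  · rw [formWedge_apply, map_smul, huδ, huu, zero_smul, zero_sub, smul_eq_mul,
      div_mul_cancel₀ _ hδ]

theorem exists_mem_apply_eq_or_eq_neg : ∃ m ∈ M, m δ = w ∨ m δ = -w := by
  obtain ⟨θ, hθ⟩ := Complex.cos_surjective (Q δ w / Q δ δ)
  rw [eq_div_iff hδ] at hθ
  by_cases hs : Complex.sin θ = 0
  · have hcos : Complex.cos θ ^ 2 = 1 := by
      rw [← Complex.sin_sq_add_cos_sq θ, hs, zero_pow two_ne_zero, zero_add]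
    rcases sq_eq_one_iff.1 hcos with h | h
    · obtain ⟨m, hm, hmw⟩ := exists_mem_apply_eq_of_form_eq hM hQ hδ hall hw
        (by rw [← hθ, h, one_mul])
      exact ⟨m, hm, Or.inl hmw⟩
    · obtain ⟨m, hm, hmw⟩ := exists_mem_apply_eq_of_form_eq hM hQ hδ hall (w := -w)
        (by simpa using hw) (by rw [map_neg, ← hθ, h, neg_one_mul, neg_neg])
      exact ⟨m, hm, Or.inr hmw⟩
  · obtain ⟨m, hm, hmw⟩ := exists_mem_apply_eq_of_sin_ne_zero hM hQ hδ hall hw hθ hs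
    exact ⟨m, hm, Or.inl hmw⟩

end

variable (hMQ : M ≤ isometryGroup Q) (hQ : ∀ x y, Q x y = Q y x) (hn : Q.Nondegenerate)
include hMQ hQ hn

theorem isometryGroup_le_of_formWedge_mem {δ : V} (hδ : Q δ δ = 2)
    (hMδ : ∃ s ∈ M, (s : V →ₗ[ℂ] V) = rankOnePerturbation Q (-1) δ)
    (hall : ∀ v, Q δ v = 0 → formWedge Q δ v ∈ hM.lieAlgebra) : isometryGroup Q ≤ M := by
  obtain ⟨s, hs, hsδ⟩ := hMδ
  refine isometryGroup_le_of_quasiReflection_mem hQ hn fun g hg c w hw hgc => ?_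
  rcases eq_zero_or_mul_eq_neg_two_of_rankOnePerturbation_mem hg hw hgc with rfl | hc
  · rw [show g = 1 from LinearEquiv.ext fun x => by
      rw [← LinearEquiv.coe_coe, hgc, rankOnePerturbation_apply, zero_mul, zero_smul, add_zero]
      rfl]
    exact M.one_mem
  obtain ⟨r, hr⟩ := IsAlgClosed.exists_pow_nat_eq (-c) two_pos
  obtain ⟨m, hm, hmδ⟩ := exists_mem_apply_eq_or_eq_neg hM hQ (hδ.trans_ne two_ne_zero) hall
    (w := r • w) (by
      rw [map_smul, map_smul, LinearMap.smul_apply, smul_eq_mul, smul_eq_mul, hδ]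
      linear_combination Q w w * hr - hc)
  have hconj : rankOnePerturbation Q (-1) (m δ) = rankOnePerturbation Q c w := by
    rcases hmδ with h | h
    · rw [h, rankOnePerturbation_smul, RingHom.id_apply]
      congr 1
      linear_combination -hr
    · rw [h, ← neg_smul, rankOnePerturbation_smul, RingHom.id_apply]
      congr 1
      linear_combination -hr
  rw [← hconj, ← coe_conj_eq_rankOnePerturbation (hMQ hm) hsδ] at hgc
  rw [LinearEquiv.toLinearMap_injective hgc]
  exact M.mul_mem (M.mul_mem hm hs) (M.inv_mem hm)

end Orthogonal

section

variable {V : Type*} [AddCommGroup V] [Module ℂ V] [FiniteDimensional ℂ V]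
  {Q : V →ₗ[ℂ] V →ₗ[ℂ] ℂ} {M : Subgroup (V ≃ₗ[ℂ] V)}

theorem splitsOrthogonally_or_finite_or_eq_isometryGroup_of_symm {R : Set V}
    (hQ : ∀ x y, Q x y = Q y x) (hn : Q.Nondegenerate) (hspan : Submodule.span ℂ R = ⊤)
    (hR : ∀ δ ∈ R, Q δ δ = 2)
    (hM : IsLeast (algebraicSubgroupsContaining ℂ (isometryGroup Q)
      (rankOnePerturbation Q (-1) '' R)) M) :
    SplitsOrthogonally Q M R ∨ Finite M ∨ M = isometryGroup Q := by
  obtain ⟨hMQ, hMalg, hMR⟩ := hM.1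
  refine or_iff_not_imp_left.2 fun hnot => or_iff_not_imp_left.2 fun hfin => le_antisymm hMQ ?_
  have hMreal := hMalg.real_of_complex
  have hR0 : ∀ δ ∈ R, Q δ δ ≠ 0 := fun δ hδ => (hR δ hδ).trans_ne two_ne_zero
  have hMδ : ∀ δ ∈ R, ∃ s ∈ M, (s : V →ₗ[ℂ] V) = rankOnePerturbation Q (-1) δ := fun δ hδ =>
    hMR _ ⟨δ, hδ, rfl⟩
  have hskew : ∀ X ∈ hMreal.lieAlgebra, ∀ x y, Q (X x) y = -Q x (X y) := fun X hX =>
    hMreal.skew_of_mem_lieAlgebra (fun _ => rfl) hMQ hX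
  have hrot : ∀ X ∈ hMreal.lieAlgebra, ∀ δ ∈ R,
      orthComponent Q δ (X δ) ∈ rotationSpace Q hMreal.lieAlgebra δ := fun X hX δ hδ =>
    orthComponent_mem_rotationSpace hMreal hMQ hQ hn (fun _ => rfl) (fun _ => rfl) (hR0 δ hδ)
      (by rw [hR δ hδ, RingHom.id_apply]; norm_num) (hMδ δ hδ) (by norm_num)
      (fun v _ hv z => formWedge_smul_of_apply_eq (B := Q) (σ := RingHom.id ℂ) rfl δ v ▸
        hMreal.smul_mem_lieAlgebra hMalg z hv) hX
  have hsplit : ∀ U : Submodule ℂ V, U ≠ ⊥ →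
      R ⊆ (U : Set V) ∪ (U.orthogonalBilin Q : Set V) → U = ⊤ := fun U hU hRU =>
    not_not.1 fun htop => hnot (splitsOrthogonally_of_subset hM
      (isAlgebraicSubgroup_stabilizer_submodule U) hU htop hRU)
  have : Infinite M := not_finite_iff_infinite.1 hfin
  obtain ⟨X, hX, hX0⟩ := (Submodule.ne_bot_iff _).1 hMreal.lieAlgebra_ne_bot
  obtain ⟨δ, hδ, hXδ⟩ : ∃ δ ∈ R, X δ ≠ 0 := by
    by_contra! h
    exact hX0 (LinearMap.ext_on hspan h)
  refine isometryGroup_le_of_formWedge_mem hMreal hMQ hQ hn (hR δ hδ) (hMδ δ hδ) fun v =>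
    formWedge_mem_of_orthComponent_ne_zero hQ hR0 hrot hn (fun _ => rfl)
      (fun X hX Y hY => hMreal.lie_mem_lieAlgebra hX hY) hspan hsplit hX hδ ?_
  rwa [orthComponent_of_orth (form_apply_self_eq_zero_of_skew hQ (hskew X hX) δ)]

end

section Unitary

open Complex

variable {V : Type*} [AddCommGroup V] [Module ℂ V] {h : V →ₗ[ℂ] V →ₗ⋆[ℂ] ℂ}

theorem formWedge_smul_mem_of_smul_mem {L : Submodule ℝ (Module.End ℂ V)} {δ v : V} {ζ : ℂ}
    (hζ : ζ.im ≠ 0) (hv : formWedge h δ v ∈ L) (hζv : formWedge h δ (ζ • v) ∈ L) (z : ℂ) :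
    formWedge h δ (z • v) ∈ L := by
  have hz : z = ((z.re - z.im / ζ.im * ζ.re : ℝ) : ℂ) + ((z.im / ζ.im : ℝ) : ℂ) * ζ := by
    apply Complex.ext
    · simp
    · simp [hζ]
  rw [hz, add_smul, mul_smul, formWedge_add, formWedge_smul_of_apply_eq (conj_ofReal _),
    formWedge_smul_of_apply_eq (conj_ofReal _), coe_smul, coe_smul]
  exact L.add_mem (L.smul_mem _ hv) (L.smul_mem _ hζv)

theorem ofReal_re_form_apply_self (hB : ∀ x y, h x y = starRingEnd ℂ (h y x)) (x : V) :
    ((h x x).re : ℂ) = h x x :=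
  conj_eq_iff_re.1 (hB x x).symm

theorem lie_formWedge_formWedge_I_smul (hB : ∀ x y, h x y = starRingEnd ℂ (h y x)) {δ a : V}
    (ha : h δ a = 0) :
    ⁅formWedge h δ a, formWedge h δ (I • a)⁆ =
      (2 * I * h δ δ) • formTensor h a a - (2 * I * h a a) • formTensor h δ δ := by
  ext x
  simp only [Ring.lie_def, LinearMap.sub_apply, LinearMap.smul_apply, Module.End.mul_apply,
    formWedge_apply, formTensor_apply, map_sub, map_smul, LinearMap.map_smulₛₗ, smul_eq_mul, ha,
    form_eq_zero_symm hB ha, conj_I]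
  module

section

variable (hB : ∀ x y, h x y = starRingEnd ℂ (h y x)) {L : Submodule ℝ (Module.End ℂ V)}
  (hLie : ∀ X ∈ L, ∀ Y ∈ L, ⁅X, Y⁆ ∈ L) {δ : V} (hδ : h δ δ ≠ 0)
  (hall : ∀ v, h δ v = 0 → formWedge h δ v ∈ L)
include hB hLie hδ hall

theorem I_smul_formTensor_self_sub_mem_of_orth {a : V} (ha : h δ a = 0) :
    I • formTensor h a a - (h a a / h δ δ * I) • formTensor h δ δ ∈ L := by
  have hlie := L.smul_mem (2 * (h δ δ).re)⁻¹ (hLie _ (hall a ha) _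
    (hall (I • a) (by rw [LinearMap.map_smulₛₗ, ha, smul_zero])))
  rw [lie_formWedge_formWedge_I_smul hB ha, ← coe_smul, ofReal_inv, ofReal_mul, ofReal_ofNat,
    ofReal_re_form_apply_self hB, smul_sub, smul_smul, smul_smul] at hlie
  convert hlie using 3 <;> field_simp

theorem I_smul_formTensor_self_sub_mem (w : V) :
    I • formTensor h w w - (h w w / h δ δ * I) • formTensor h δ δ ∈ L := by
  obtain ⟨z, a, ha, rfl⟩ : ∃ (z : ℂ) (a : V), h δ a = 0 ∧ w = z • δ + a :=
    ⟨_, orthComponent h δ w, form_eq_zero_symm hB (form_orthComponent_apply_self hδ w),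
      (add_sub_cancel _ _).symm⟩
  have hsum := L.add_mem (I_smul_formTensor_self_sub_mem_of_orth hB hLie hδ hall ha)
    (hall ((I * starRingEnd ℂ z) • a) (by rw [LinearMap.map_smulₛₗ, ha, smul_zero]))
  have haδ : h a δ = 0 := form_eq_zero_symm hB ha
  have hnorm : h (z • δ + a) (z • δ + a) / h δ δ = z * starRingEnd ℂ z + h a a / h δ δ := by
    simp only [map_add, map_smul, LinearMap.map_smulₛₗ, LinearMap.add_apply, LinearMap.smul_apply,
      smul_eq_mul, ha, haδ]
    field_simp
    ring
  convert hsum using 1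
  rw [hnorm]
  ext x
  simp only [LinearMap.add_apply, LinearMap.sub_apply, LinearMap.smul_apply, formTensor_apply,
    formWedge_apply, map_add, LinearMap.map_smulₛₗ, map_mul, conj_I, conj_conj, smul_eq_mul]
  module

end

theorem formTensor_add_formTensor_swap_mem_span (a b : V) :
    formTensor h a b + formTensor h b a ∈
      Submodule.span ℝ (Set.range fun w => formTensor h w w) := by
  have hpolar : formTensor h a b + formTensor h b a =
      formTensor h (a + b) (a + b) - formTensor h a a - formTensor h b b := by
    ext x
    simp only [LinearMap.add_apply, LinearMap.sub_apply, formTensor_apply, map_add]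
    module
  have hmem (w : V) : formTensor h w w ∈ Submodule.span ℝ (Set.range fun w => formTensor h w w) :=
    Submodule.subset_span ⟨w, rfl⟩
  rw [hpolar]
  exact sub_mem (sub_mem (hmem _) (hmem _)) (hmem _)

section

variable [FiniteDimensional ℂ V] (hn : h.Nondegenerate)
include hn

theorem exists_form_eq_dual (φ : Module.Dual ℂ V) : ∃ y, ∀ x, h x y = φ x := by
  let f : V →ₗ[ℝ] Module.Dual ℂ V :=
    { toFun := fun y => h.flip y
      map_add' := fun y z => map_add _ _ _
      map_smul' := fun r y => by
        rw [← coe_smul, LinearMap.map_smulₛₗ, conj_ofReal, coe_smul, RingHom.id_apply] }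
  have hinj : Function.Injective f :=
    (injective_iff_map_eq_zero f).2 fun y hy => hn.2 y fun x => LinearMap.congr_fun hy x
  have hdim : Module.finrank ℝ V = Module.finrank ℝ (Module.Dual ℂ V) := by
    rw [finrank_real_of_complex, finrank_real_of_complex, Subspace.dual_finrank_eq]
  obtain ⟨y, hy⟩ := (LinearMap.injective_iff_surjective_of_finrank_eq_finrank hdim).1 hinj φ
  exact ⟨y, fun x => LinearMap.congr_fun hy x⟩

variable (hB : ∀ x y, h x y = starRingEnd ℂ (h y x))
include hB

/-- With dual bases `b` and `f`, both `∑ f_j ⊗ b_j` and its adjoint `∑ b_j ⊗ f_j` are the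
identity. -/
theorem one_mem_span_formTensor_self :
    (1 : Module.End ℂ V) ∈ Submodule.span ℝ (Set.range fun w => formTensor h w w) := by
  let b := Module.finBasis ℂ V
  choose f hf using fun j => exists_form_eq_dual hn (b.coord j)
  have hdual (x : V) : ∑ j, h x (f j) • b j = x := by
    simp only [hf]
    exact b.sum_repr x
  have hone : ∑ j, formTensor h (f j) (b j) = 1 := LinearMap.ext fun x => by
    rw [LinearMap.sum_apply]
    exact hdual x
  have hadj : ∑ j, formTensor h (b j) (f j) = 1 := LinearMap.ext fun x => by
    refine sub_eq_zero.1 (hn.2 _ fun y => ?_)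
    rw [map_sub, sub_eq_zero, LinearMap.sum_apply, map_sum, Module.End.one_apply]
    conv_rhs => rw [← hdual y, map_sum, LinearMap.sum_apply]
    refine Finset.sum_congr rfl fun j _ => ?_
    rw [formTensor_apply, LinearMap.map_smulₛₗ, ← hB, map_smul, LinearMap.smul_apply, smul_eq_mul,
      smul_eq_mul, mul_comm]
  have htwo : (2 : ℝ) • (1 : Module.End ℂ V) ∈
      Submodule.span ℝ (Set.range fun w => formTensor h w w) := by
    rw [two_smul]
    nth_rewrite 1 [← hone]
    rw [← hadj, ← Finset.sum_add_distrib]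
    exact sum_mem fun j _ => formTensor_add_formTensor_swap_mem_span _ _
  exact (Submodule.smul_mem_iff _ two_ne_zero).1 htwo

variable {L : Submodule ℝ (Module.End ℂ V)} (hLie : ∀ X ∈ L, ∀ Y ∈ L, ⁅X, Y⁆ ∈ L) {δ : V}
  (hδ : h δ δ ≠ 0) (hall : ∀ v, h δ v = 0 → formWedge h δ v ∈ L)
include hLie hδ hall

theorem I_smul_one_sub_mem :
    I • (1 : Module.End ℂ V) - (Module.finrank ℂ V / h δ δ * I) • formTensor h δ δ ∈ L := by
  let Φ : Module.End ℂ V →ₗ[ℝ] Module.End ℂ V := (LinearMap.restrictScalars ℝ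
    (I • LinearMap.id - ((h δ δ)⁻¹ * I) • (LinearMap.trace ℂ V).smulRight (formTensor h δ δ)))
  have hΦ (X : Module.End ℂ V) :
      Φ X = I • X - (LinearMap.trace ℂ V X / h δ δ * I) • formTensor h δ δ := by
    change I • X - ((h δ δ)⁻¹ * I) • LinearMap.trace ℂ V X • formTensor h δ δ = _
    rw [smul_smul]
    ring_nf
  have hle : Submodule.span ℝ (Set.range fun w => formTensor h w w) ≤ L.comap Φ := by
    rw [Submodule.span_le]
    rintro _ ⟨w, rfl⟩
    change Φ (formTensor h w w) ∈ L
    rw [hΦ, formTensor, LinearMap.trace_smulRight]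
    exact I_smul_formTensor_self_sub_mem hB hLie hδ hall w
  have hmem : Φ 1 ∈ L := hle (one_mem_span_formTensor_self hn hB)
  rwa [hΦ, LinearMap.trace_one] at hmem

theorem I_smul_formTensor_self_mem_sup (w : V) :
    I • formTensor h w w ∈ L ⊔ Submodule.span ℝ {I • (1 : Module.End ℂ V)} := by
  have hd : (Module.finrank ℂ V : ℂ) ≠ 0 := Nat.cast_ne_zero.2
    (Module.finrank_pos_iff_exists_ne_zero.2 ⟨δ, fun h0 => hδ (by rw [h0, map_zero])⟩).ne'
  set t : ℝ := (h w w).re / Module.finrank ℂ V with ht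
  refine Submodule.mem_sup.2 ⟨_, L.sub_mem (I_smul_formTensor_self_sub_mem hB hLie hδ hall w)
    (L.smul_mem t (I_smul_one_sub_mem hn hB hLie hδ hall)), t • I • (1 : Module.End ℂ V),
    Submodule.smul_mem _ t (Submodule.mem_span_singleton_self _), ?_⟩
  have htd : (t : ℂ) * Module.finrank ℂ V = h w w := by
    rw [ht, ofReal_div, ofReal_natCast, ofReal_re_form_apply_self hB, div_mul_cancel₀ _ hd]
  rw [← coe_smul, ← coe_smul, ← htd]
  module

end

end Unitary

section ProjectiveImage

variable {V : Type*} [AddCommGroup V] [Module ℂ V]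

/-- The automorphisms that lie in `M` up to a scalar of modulus one. -/
def unitScalarExtension (M : Subgroup (V ≃ₗ[ℂ] V)) : Subgroup (V ≃ₗ[ℂ] V) where
  carrier := {g | ∃ u : ℂ, ‖u‖ = 1 ∧ ∃ m ∈ M, ∀ x, g x = u • m x}
  one_mem' := ⟨1, norm_one, 1, M.one_mem, fun x => (one_smul ℂ x).symm⟩
  mul_mem' := by
    rintro g g' ⟨u, hu, m, hm, hg⟩ ⟨u', hu', m', hm', hg'⟩
    refine ⟨u * u', by rw [norm_mul, hu, hu', one_mul], m * m', M.mul_mem hm hm', fun x => ?_⟩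
    rw [LinearEquiv.mul_apply, hg, hg', map_smul, smul_smul, LinearEquiv.mul_apply]
  inv_mem' := by
    rintro g ⟨u, hu, m, hm, hg⟩
    have hu0 : u ≠ 0 := norm_ne_zero_iff.1 (hu.trans_ne one_ne_zero)
    refine ⟨u⁻¹, by rw [norm_inv, hu, inv_one], m⁻¹, M.inv_mem hm, fun x => g.injective ?_⟩
    rw [hg (u⁻¹ • _), map_smul, smul_inv_smul₀ hu0]
    exact (g.apply_symm_apply x).trans (m.apply_symm_apply x).symm

theorem projectiveImage_eq_top_of_le_unitScalarExtension {σ : ℂ →+* ℂ}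
    {B : V →ₗ[ℂ] V →ₛₗ[σ] ℂ} {M : Subgroup (V ≃ₗ[ℂ] V)} (hM : M ≤ isometryGroup B)
    (hall : isometryGroup B ≤ unitScalarExtension M) : projectiveImage B M = ⊤ := by
  rw [eq_top_iff]
  rintro q -
  obtain ⟨⟨g, hg⟩, rfl⟩ := QuotientGroup.mk_surjective q
  obtain ⟨u, -, m, hm, hgm⟩ := hall hg
  refine ⟨⟨m, hM hm⟩, hm, QuotientGroup.eq.2 (Subgroup.mem_center_iff.2 ?_)⟩
  rintro ⟨k, hk⟩
  have hscalar (x : V) : (m⁻¹ * g) x = u • x := by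
    rw [LinearEquiv.mul_apply, hgm, map_smul, show m⁻¹ (m x) = x from m.symm_apply_apply x]
  refine Subtype.ext (LinearEquiv.ext fun x => ?_)
  change k ((m⁻¹ * g) x) = (m⁻¹ * g) (k x)
  rw [hscalar, hscalar, map_smul]

end ProjectiveImage

section UnitaryGroup

open Complex

variable {V : Type*} [AddCommGroup V] [Module ℂ V] {h : V →ₗ[ℂ] V →ₗ⋆[ℂ] ℂ}

theorem norm_eq_one_of_rankOnePerturbation_mem {g : V ≃ₗ[ℂ] V} (hg : g ∈ isometryGroup h) {c : ℂ}
    {w : V} (hw : h w w ≠ 0) (hgc : (g : V →ₗ[ℂ] V) = rankOnePerturbation h c w) :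
    ‖1 + c * h w w‖ = 1 := by
  have happ : g w = (1 + c * h w w) • w := by
    rw [← LinearEquiv.coe_coe, hgc, rankOnePerturbation_apply, add_smul, one_smul]
  have hnorm := hg w w
  rw [happ, LinearMap.map_smulₛₗ, map_smul, LinearMap.smul_apply, smul_eq_mul, smul_eq_mul,
    ← mul_assoc, mul_eq_right₀ hw, conj_mul'] at hnorm
  exact (pow_eq_one_iff_of_nonneg (norm_nonneg _) two_ne_zero).1 (by exact_mod_cast hnorm)

theorem exists_smul_of_orthComponent_eq_zero (hB : ∀ x y, h x y = starRingEnd ℂ (h y x))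
    {R : Set V} (hR : ∀ δ ∈ R, h δ δ ≠ 0) (hspan : Submodule.span ℂ R = ⊤)
    (hsplit : ∀ U : Submodule ℂ V, U ≠ ⊥ →
      R ⊆ (U : Set V) ∪ (U.orthogonalBilin h : Set V) → U = ⊤)
    {X : Module.End ℂ V} (hX : ∀ x y, h (X x) y = -h x (X y)) (hX0 : X ≠ 0)
    (hXR : ∀ δ ∈ R, orthComponent h δ (X δ) = 0) :
    ∃ t : ℝ, t ≠ 0 ∧ X = (t * I) • (1 : Module.End ℂ V) := by
  have hskew (δ : V) : starRingEnd ℂ (h (X δ) δ / h δ δ) = -(h (X δ) δ / h δ δ) := by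
    rw [map_div₀, ← hB, ← hB, hX δ δ, neg_div, neg_neg]
  have heig : ∀ δ ∈ R, X δ = (h (X δ) δ / h δ δ) • δ := fun δ hδ => sub_eq_zero.1 (hXR δ hδ)
  obtain ⟨δ, hδ, hXδ⟩ : ∃ δ ∈ R, X δ ≠ 0 := by
    by_contra! hzero
    exact hX0 (LinearMap.ext_on hspan hzero)
  set μ := h (X δ) δ / h δ δ with hμ
  have htop : Module.End.eigenspace X μ = ⊤ := by
    refine hsplit _ ((Submodule.ne_bot_iff _).2 ⟨δ, Module.End.mem_eigenspace_iff.2 (heig δ hδ),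
      fun h0 => hR δ hδ (by rw [h0, map_zero])⟩) fun r hr => ?_
    by_cases hμr : h (X r) r / h r r = μ
    · exact Or.inl (Module.End.mem_eigenspace_iff.2 (hμr ▸ heig r hr))
    · refine Or.inr (Submodule.mem_orthogonalBilin_iff.2 fun u hu => ?_)
      have hur := hX u r
      rw [Module.End.mem_eigenspace_iff.1 hu, heig r hr, map_smul, LinearMap.smul_apply,
        LinearMap.map_smulₛₗ, hskew, smul_eq_mul, smul_eq_mul, neg_mul, neg_neg] at hur
      exact not_not.1 fun hne => hμr (mul_right_cancel₀ hne hur).symm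
  have hXμ (x : V) : X x = μ • x := Module.End.mem_eigenspace_iff.1 (htop ▸ Submodule.mem_top)
  obtain ⟨t, ht⟩ : ∃ t : ℝ, μ = t * I := by
    have hre := congrArg re (hskew δ)
    rw [← hμ, conj_re, neg_re, self_eq_neg] at hre
    exact ⟨μ.im, by rw [← re_add_im μ, hre, ofReal_zero, zero_add, im_ofReal_mul, I_im, mul_one]⟩
  refine ⟨t, ?_, LinearMap.ext fun x => ht ▸ hXμ x⟩
  rintro rfl
  exact hXδ (by rw [hXμ, ht, ofReal_zero, zero_mul, zero_smul])

theorem add_conj_add_mul_conj_mul_eq_zero {c d ζ : ℂ} (hd0 : d ≠ 0) (hd : starRingEnd ℂ d = d)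
    (hc : c * d = ζ - 1) (hζ : ‖ζ‖ = 1) :
    c + starRingEnd ℂ c + c * starRingEnd ℂ c * d = 0 := by
  have hc' : starRingEnd ℂ c * d = starRingEnd ℂ ζ - 1 := by
    rw [← map_one (starRingEnd ℂ), ← map_sub, ← hc, map_mul, hd]
  have hζζ : ζ * starRingEnd ℂ ζ = 1 := by rw [mul_conj', hζ, ofReal_one, one_pow]
  refine (mul_eq_zero.1 ?_).resolve_right hd0
  linear_combination (1 + starRingEnd ℂ c * d) * hc + ζ * hc' + hζζ

variable [FiniteDimensional ℂ V]

theorem rankOnePerturbation_mem_detPowOneSubgroup {g : V ≃ₗ[ℂ] V} {c ζ : ℂ} {δ : V}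
    (hδ : c * h δ δ = ζ - 1) {n : ℕ} (hζ : ζ ^ n = 1)
    (hg : (g : V →ₗ[ℂ] V) = rankOnePerturbation h c δ) : g ∈ detPowOneSubgroup V n := by
  have htransvection : (g : V →ₗ[ℂ] V) = LinearMap.transvection (c • h.flip δ) δ := hg
  rw [mem_detPowOneSubgroup, htransvection, LinearMap.transvection.det, LinearMap.smul_apply,
    LinearMap.flip_apply, smul_eq_mul, hδ, add_sub_cancel, hζ]

variable {M : Subgroup (V ≃ₗ[ℂ] V)} (hM : IsAlgebraicSubgroup ℝ M)

theorem not_le_detPowOneSubgroup_of_smul_one_mem [Nontrivial V] {t : ℝ} (ht : t ≠ 0)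
    (hmem : (t * I) • (1 : Module.End ℂ V) ∈ hM.lieAlgebra) {n : ℕ} (hn : n ≠ 0) :
    ¬M ≤ detPowOneSubgroup V n := by
  intro hle
  have hd : (Module.finrank ℂ V : ℂ) ≠ 0 := Nat.cast_ne_zero.2 Module.finrank_pos.ne'
  set s : ℝ := Real.pi / (t * Module.finrank ℂ V * n) with hs
  obtain ⟨m, hm, hmX, -⟩ := hM.exists_exp_mem (hM.lieAlgebra.smul_mem s hmem)
  have hms : (m : V →ₗ[ℂ] V) = exp (s * (t * I)) • (1 : V →ₗ[ℂ] V) :=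
    LinearMap.ext fun x => hmX x _ (by
      rw [← coe_smul, smul_smul]
      rfl)
  have hexp : (n : ℂ) * (Module.finrank ℂ V * (s * (t * I))) = Real.pi * I := by
    have hn' : (n : ℂ) ≠ 0 := Nat.cast_ne_zero.2 hn
    have ht' : (t : ℂ) ≠ 0 := ofReal_ne_zero.2 ht
    rw [hs]
    push_cast
    field_simp
  have hdet := mem_detPowOneSubgroup.1 (hle hm)
  rw [hms, LinearMap.det_smul, map_one, mul_one, ← exp_nat_mul, ← exp_nat_mul, hexp,
    exp_pi_mul_I] at hdet
  norm_num at hdet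

variable (hB : ∀ x y, h x y = starRingEnd ℂ (h y x))
include hB

theorem formWedge_smul_mem_lieAlgebra (hMh : M ≤ isometryGroup h) (hn : h.Nondegenerate) {c : ℂ}
    {δ : V} (hδ : h δ δ ≠ 0) (hc : c + starRingEnd ℂ c + c * starRingEnd ℂ c * h δ δ = 0)
    (hMδ : ∃ s ∈ M, (s : V →ₗ[ℂ] V) = rankOnePerturbation h c δ) (him : (c * h δ δ).im ≠ 0)
    {v : V} (hv : h δ v = 0) (hvM : formWedge h δ v ∈ hM.lieAlgebra) (z : ℂ) :
    formWedge h δ (z • v) ∈ hM.lieAlgebra := by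
  have hmem := formWedge_smul_orthComponent_mem hM hMh hB hn conj_conj conj_ofReal hδ hc hMδ hvM
  have hcomp : orthComponent h δ (formWedge h δ v δ) = h δ δ • v := by
    rw [formWedge_apply, hv, zero_smul, sub_zero, orthComponent_of_orth (by
      rw [map_smul, LinearMap.smul_apply, form_eq_zero_symm hB hv, smul_zero])]
  have hconj : starRingEnd ℂ c * h δ δ = starRingEnd ℂ (c * h δ δ) := by rw [map_mul, ← hB]
  rw [hcomp, smul_smul, hconj] at hmem
  exact formWedge_smul_mem_of_smul_mem (by rwa [conj_im, neg_ne_zero]) hvM hmem z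

theorem exists_mem_apply_eq_exp_smul {w : V} (hw : h w w ≠ 0)
    (hmem : I • formTensor h w w ∈ hM.lieAlgebra ⊔ Submodule.span ℝ {I • (1 : Module.End ℂ V)})
    (θ : ℝ) :
    ∃ m ∈ M, ∃ τ : ℝ, m w = exp (τ * I) • exp (θ * I) • w ∧
      ∀ x, h x w = 0 → m x = exp (τ * I) • x := by
  have hww := ofReal_re_form_apply_self hB w
  obtain ⟨X, hX, Y, hY, hXY⟩ := Submodule.mem_sup.1
    (Submodule.smul_mem _ (θ / (h w w).re) hmem)
  obtain ⟨τ, rfl⟩ := Submodule.mem_span_singleton.1 hY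
  have hXapp (x : V) : X x = (θ / h w w * I * h x w) • w + ((-τ : ℝ) * I) • x := by
    rw [← coe_smul, ← coe_smul, ofReal_div, hww] at hXY
    rw [eq_sub_of_add_eq hXY]
    simp only [LinearMap.sub_apply, LinearMap.smul_apply, formTensor_apply, Module.End.one_apply,
      ofReal_neg]
    module
  obtain ⟨m, hm, hmX, -⟩ := hM.exists_exp_mem hX
  refine ⟨m, hm, -τ, ?_, fun x hx => hmX x _ ?_⟩
  · rw [smul_smul, ← exp_add]
    refine hmX w _ ?_
    rw [hXapp, mul_right_comm, div_mul_cancel₀ _ hw, add_smul, add_comm]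
  · rw [hXapp, hx, mul_zero, zero_smul, zero_add]

theorem isometryGroup_le_unitScalarExtension (hn : h.Nondegenerate)
    (hall : ∀ w, I • formTensor h w w ∈
      hM.lieAlgebra ⊔ Submodule.span ℝ {I • (1 : Module.End ℂ V)}) :
    isometryGroup h ≤ unitScalarExtension M := by
  refine isometryGroup_le_of_quasiReflection_mem hB hn fun g hg c w hw hgc => ?_
  obtain ⟨θ, hθ⟩ := (norm_eq_one_iff _).1 (norm_eq_one_of_rankOnePerturbation_mem hg hw hgc)
  obtain ⟨m, hm, τ, hmw, hmorth⟩ := exists_mem_apply_eq_exp_smul hM hB hw (hall w) θ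
  refine ⟨exp ((-τ : ℝ) * I), norm_exp_ofReal_mul_I _, m, hm, fun x => ?_⟩
  obtain ⟨z, y, hy, rfl⟩ : ∃ (z : ℂ) (y : V), h y w = 0 ∧ x = z • w + y :=
    ⟨_, orthComponent h w x, form_orthComponent_apply_self hw x, (add_sub_cancel _ _).symm⟩
  have hexp : exp ((-τ : ℝ) * I) * exp (τ * I) = 1 := by
    rw [← exp_add, ofReal_neg, neg_mul, neg_add_cancel, exp_zero]
  rw [map_add m, map_smul, hmw, hmorth y hy, hθ, ← LinearEquiv.coe_coe, hgc,
    rankOnePerturbation_apply, map_add, map_smul, LinearMap.add_apply, LinearMap.smul_apply, hy]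
  linear_combination (norm := module) -hexp • (y + (z * (1 + c * h w w)) • w)

end UnitaryGroup

section

open Complex

variable {V : Type*} [AddCommGroup V] [Module ℂ V] [FiniteDimensional ℂ V]
  {h : V →ₗ[ℂ] V →ₗ⋆[ℂ] ℂ} {M : Subgroup (V ≃ₗ[ℂ] V)}

theorem exists_mem_orthComponent_ne_zero {R : Set V} {c ζ : ℂ}
    (hB : ∀ x y, h x y = starRingEnd ℂ (h y x)) (hspan : Submodule.span ℂ R = ⊤) {n : ℕ}
    (hn0 : n ≠ 0) (hζn : ζ ^ n = 1) (hR0 : ∀ δ ∈ R, h δ δ ≠ 0)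
    (hR : ∀ δ ∈ R, c * h δ δ = ζ - 1)
    (hsplit : ∀ U : Submodule ℂ V, U ≠ ⊥ →
      R ⊆ (U : Set V) ∪ (U.orthogonalBilin h : Set V) → U = ⊤)
    (hM : IsLeast (algebraicSubgroupsContaining ℝ (isometryGroup h)
      (rankOnePerturbation h c '' R)) M)
    {X : Module.End ℂ V} (hX : X ∈ hM.1.2.1.lieAlgebra) (hX0 : X ≠ 0) :
    ∃ δ ∈ R, orthComponent h δ (X δ) ≠ 0 := by
  by_contra! hzero
  obtain ⟨t, ht, rfl⟩ := exists_smul_of_orthComponent_eq_zero hB hR0 hspan hsplit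
    (hM.1.2.1.skew_of_mem_lieAlgebra conj_ofReal hM.1.1 hX) hX0 hzero
  have : Nontrivial V := by
    by_contra! hV
    exact hX0 (Subsingleton.elim _ _)
  refine not_le_detPowOneSubgroup_of_smul_one_mem hM.1.2.1 ht hX hn0
    (le_of_isLeast_algebraicSubgroupsContaining hM
      (isAlgebraicSubgroup_detPowOneSubgroup n).real_of_complex ?_)
  rintro g ⟨δ, hδ, hgδ⟩
  exact rankOnePerturbation_mem_detPowOneSubgroup (hR δ hδ) hζn hgδ.symm

theorem splitsOrthogonally_or_finite_or_projectiveImage_eq_top {R : Set V} {c ζ : ℂ}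
    (hB : ∀ x y, h x y = starRingEnd ℂ (h y x)) (hn : h.Nondegenerate)
    (hspan : Submodule.span ℂ R = ⊤) {n : ℕ} (hn0 : n ≠ 0) (hζn : ζ ^ n = 1) (hζ : ζ.im ≠ 0)
    (hR : ∀ δ ∈ R, c * h δ δ = ζ - 1)
    (hM : IsLeast (algebraicSubgroupsContaining ℝ (isometryGroup h)
      (rankOnePerturbation h c '' R)) M) :
    SplitsOrthogonally h M R ∨ Finite M ∨ projectiveImage h M = ⊤ := by
  obtain ⟨hMh, hMalg, hMR⟩ := hM.1
  refine or_iff_not_imp_left.2 fun hnot => or_iff_not_imp_left.2 fun hfin => ?_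
  have hMδ : ∀ δ ∈ R, ∃ s ∈ M, (s : V →ₗ[ℂ] V) = rankOnePerturbation h c δ := fun δ hδ =>
    hMR _ ⟨δ, hδ, rfl⟩
  have hcR : ∀ δ ∈ R, c * h δ δ ≠ 0 := fun δ hδ h0 => hζ (by
    rw [sub_eq_zero.1 ((hR δ hδ).symm.trans h0), one_im])
  have hR0 : ∀ δ ∈ R, h δ δ ≠ 0 := fun δ hδ => right_ne_zero_of_mul (hcR δ hδ)
  have hc : ∀ δ ∈ R, c + starRingEnd ℂ c + c * starRingEnd ℂ c * h δ δ = 0 := fun δ hδ =>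
    add_conj_add_mul_conj_mul_eq_zero (hR0 δ hδ) (hB δ δ).symm (hR δ hδ)
      (norm_eq_one_of_pow_eq_one hζn hn0)
  have hrot : ∀ X ∈ hMalg.lieAlgebra, ∀ δ ∈ R,
      orthComponent h δ (X δ) ∈ rotationSpace h hMalg.lieAlgebra δ := fun X hX δ hδ =>
    orthComponent_mem_rotationSpace hMalg hMh hB hn conj_conj conj_ofReal (hR0 δ hδ)
      (hc δ hδ) (hMδ δ hδ) (left_ne_zero_of_mul (hcR δ hδ))
      (fun _ => formWedge_smul_mem_lieAlgebra hMalg hB hMh hn (hR0 δ hδ) (hc δ hδ) (hMδ δ hδ)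
        (by rwa [hR δ hδ, sub_im, one_im, sub_zero])) hX
  have hsplit : ∀ U : Submodule ℂ V, U ≠ ⊥ →
      R ⊆ (U : Set V) ∪ (U.orthogonalBilin h : Set V) → U = ⊤ := fun U hU hRU =>
    not_not.1 fun htop => hnot (splitsOrthogonally_of_subset hM
      (isAlgebraicSubgroup_stabilizer_submodule U).real_of_complex hU htop hRU)
  have : Infinite M := not_finite_iff_infinite.1 hfin
  obtain ⟨X, hX, hX0⟩ := (Submodule.ne_bot_iff _).1 hMalg.lieAlgebra_ne_bot
  obtain ⟨δ, hδ, hXδ⟩ := exists_mem_orthComponent_ne_zero hB hspan hn0 hζn hR0 hR hsplit hM hX hX0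
  have hLie : ∀ X ∈ hMalg.lieAlgebra, ∀ Y ∈ hMalg.lieAlgebra, ⁅X, Y⁆ ∈ hMalg.lieAlgebra :=
    fun X hX Y hY => hMalg.lie_mem_lieAlgebra hX hY
  exact projectiveImage_eq_top_of_le_unitScalarExtension hMh
    (isometryGroup_le_unitScalarExtension hMalg hB hn
      (I_smul_formTensor_self_mem_sup hn hB hLie (hR0 δ hδ) fun v =>
        formWedge_mem_of_orthComponent_ne_zero hB hR0 hrot hn conj_conj hLie hspan hsplit hX hδ
          hXδ))

end

theorem im_ne_zero_of_pow_eq_one {ζ : ℂ} {n : ℕ} (hn : n ≠ 0) (hζ : ζ ^ n = 1) (h1 : ζ ≠ 1)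
    (hneg : ζ ≠ -1) : ζ.im ≠ 0 := by
  intro him
  have hre : ζ = (ζ.re : ℂ) := (Complex.conj_eq_iff_re.1 (Complex.conj_eq_iff_im.2 him)).symm
  have hnorm := Complex.norm_eq_one_of_pow_eq_one hζ hn
  rw [hre, Complex.norm_real, Real.norm_eq_abs] at hnorm
  rcases eq_or_eq_neg_of_abs_eq hnorm with hre1 | hre1
  · exact h1 (by rw [hre, hre1, Complex.ofReal_one])
  · exact hneg (by rw [hre, hre1, Complex.ofReal_neg, Complex.ofReal_one])

theorem mainTheorem10_general {V : Type*} [AddCommGroup V] [Module ℂ V] [FiniteDimensional ℂ V] :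
    (∀ (Q : V →ₗ[ℂ] V →ₗ[ℂ] ℂ) (R : Set V) (M : Subgroup (V ≃ₗ[ℂ] V)),
      Q.IsAlt → Q.Nondegenerate → Submodule.span ℂ R = ⊤ →
      M = algebraicHull ℂ (isometryGroup Q) ((fun δ => rankOnePerturbation Q 1 δ) '' R) →
        SplitsOrthogonally Q M R ∨ M = isometryGroup Q) ∧
    (∀ (Q : V →ₗ[ℂ] V →ₗ[ℂ] ℂ) (R : Set V) (M : Subgroup (V ≃ₗ[ℂ] V)),
      (∀ x y, Q x y = Q y x) → Q.Nondegenerate → Submodule.span ℂ R = ⊤ →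
      (∀ δ ∈ R, Q δ δ = 2) →
      M = algebraicHull ℂ (isometryGroup Q) ((fun δ => rankOnePerturbation Q (-1) δ) '' R) →
        SplitsOrthogonally Q M R ∨ Finite M ∨ M = isometryGroup Q) ∧
    (∀ (ε : ℂ) (h : V →ₗ[ℂ] V →ₗ⋆[ℂ] ℂ) (R : Set V) (ζ : ℂ) (M : Subgroup (V ≃ₗ[ℂ] V)),
      (ε = 1 ∨ ε = -1) →
      (∀ x y, h x y = starRingEnd ℂ (h y x)) → h.Nondegenerate → Submodule.span ℂ R = ⊤ →
      (∃ n : ℕ, 0 < n ∧ ζ ^ n = 1) → ζ ≠ 1 → ζ ≠ -1 →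
      (∀ δ ∈ R, h δ δ = ε) →
      M = algebraicHull ℝ (isometryGroup h)
        ((fun δ => rankOnePerturbation h (ε * (ζ - 1)) δ) '' R) →
        SplitsOrthogonally h M R ∨ Finite M ∨ projectiveImage h M = ⊤) := by
  refine ⟨?_, ?_, ?_⟩
  · rintro Q R _ hQ hn hspan rfl
    exact splitsOrthogonally_or_eq_isometryGroup_of_isAlt one_ne_zero hQ hn hspan
      (isLeast_algebraicHull_rankOnePerturbation (isAlgebraicSubgroup_isometryGroup Q) hn
        fun δ _ => form_rankOnePerturbation_apply_of_isAlt hQ 1 δ)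
  · rintro Q R _ hQ hn hspan hR rfl
    exact splitsOrthogonally_or_finite_or_eq_isometryGroup_of_symm hQ hn hspan hR
      (isLeast_algebraicHull_rankOnePerturbation (isAlgebraicSubgroup_isometryGroup Q) hn
        fun δ hδ => form_rankOnePerturbation_apply hQ (by rw [hR δ hδ]; norm_num))
  · rintro ε h R ζ _ hε hB hn hspan ⟨n, hn0, hζn⟩ hζ1 hζneg hR rfl
    have hεε : ε * ε = 1 := mul_self_eq_one_iff.2 hε
    have hcR : ∀ δ ∈ R, ε * (ζ - 1) * h δ δ = ζ - 1 := fun δ hδ => by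
      rw [hR δ hδ, mul_right_comm, hεε, one_mul]
    refine splitsOrthogonally_or_finite_or_projectiveImage_eq_top hB hn hspan hn0.ne' hζn
      (im_ne_zero_of_pow_eq_one hn0.ne' hζn hζ1 hζneg) hcR
      (isLeast_algebraicHull_rankOnePerturbation (isAlgebraicSubgroup_real_isometryGroup h) hn
        fun δ hδ => form_rankOnePerturbation_apply hB ?_)
    exact add_conj_add_mul_conj_mul_eq_zero (hR δ hδ ▸ left_ne_zero_of_mul_eq_one hεε)
      (hB δ δ).symm (hcR δ hδ) (Complex.norm_eq_one_of_pow_eq_one hζn hn0.ne')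

theorem mainTheorem10 {V : Type*} [AddCommGroup V] [Module ℂ V] [FiniteDimensional ℂ V] :
    -- alternating form, transvections
    (∀ (Q : V →ₗ[ℂ] V →ₗ[ℂ] ℂ) (R : Set V) (M : Subgroup (V ≃ₗ[ℂ] V)),
      Q.IsAlt → Q.Nondegenerate → Submodule.span ℂ R = ⊤ →
      M = algebraicHull ℂ (isometryGroup Q)
        ((fun δ => rankOnePerturbation Q 1 δ) '' R) →
      IsFiniteUnionOfOrbits M R →
        SplitsOrthogonally Q M R ∨ M = isometryGroup Q) ∧
    -- symmetric form, reflections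
    (∀ (Q : V →ₗ[ℂ] V →ₗ[ℂ] ℂ) (R : Set V) (M : Subgroup (V ≃ₗ[ℂ] V)),
      (∀ x y, Q x y = Q y x) → Q.Nondegenerate → Submodule.span ℂ R = ⊤ →
      (∀ δ ∈ R, Q δ δ = 2) →
      M = algebraicHull ℂ (isometryGroup Q)
        ((fun δ => rankOnePerturbation Q (-1) δ) '' R) →
      IsFiniteUnionOfOrbits M R →
        SplitsOrthogonally Q M R ∨ Finite M ∨ M = isometryGroup Q) ∧
    -- Hermitian form, complex reflections
    (∀ (ε : ℂ) (h : V →ₗ[ℂ] V →ₗ⋆[ℂ] ℂ) (R : Set V) (ζ : ℂ) (M : Subgroup (V ≃ₗ[ℂ] V)),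
      (ε = 1 ∨ ε = -1) →
      (∀ x y, h x y = starRingEnd ℂ (h y x)) → h.Nondegenerate → Submodule.span ℂ R = ⊤ →
      (∃ n : ℕ, 0 < n ∧ ζ ^ n = 1) → ζ ≠ 1 → ζ ≠ -1 →
      (∀ δ ∈ R, h δ δ = ε) →
      M = algebraicHull ℝ (isometryGroup h)
        ((fun δ => rankOnePerturbation h (ε * (ζ - 1)) δ) '' R) →
      1 < Module.finrank ℂ V →
      IsFiniteUnionOfOrbits M R →
        SplitsOrthogonally h M R ∨ Finite M ∨ projectiveImage h M = ⊤) := by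
  obtain ⟨halt, hsymm, hherm⟩ := mainTheorem10_general (V := V)
  exact ⟨fun Q R M hQ hn hspan hM _ => halt Q R M hQ hn hspan hM,
    fun Q R M hQ hn hspan hR hM _ => hsymm Q R M hQ hn hspan hR hM,
    fun ε h R ζ M hε hB hn hspan hζ h1 hneg hR hM _ _ =>
      hherm ε h R ζ M hε hB hn hspan hζ h1 hneg hR hM⟩
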